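/- Let $K$ be a field and let $q\in K$ satisfy $q^n\neq 1$ for all $n\ge 1$ (for instance $K=\mathbb C(q)$ with $q$ an indeterminate). Let $\mathbf{Sym}$ be the algebra of noncommutative symmetric functions over $K$, that is, the free associative algebra on generators $S_1,S_2,\dots$ with $\deg S_n=n$; put $S_0=1$. For a composition $I=(i_1,\dots,i_r)$ of $n$ write $\ell(I)=r$, $S^I=S_{i_1}\cdots S_{i_r}$, and $\mathrm{Des}(I)=\{i_1,i_1+i_2,\dots,i_1+\cdots+i_{r-1}\}$. The ribbon function is $R_I=\sum_J(-1)^{\ell(I)-\ell(J)}S^J$, summed over the compositions $J$ of $n$ with $\mathrm{Des}(J)\subseteq\mathrm{Des}(I)$; the $R_I$, for $I$ a composition of $n$, form a basis of the homogeneous component $\mathbf{Sym}_n$. The conjugate $I^\sim$ of $I$ is the composition of $n$ with $\mathrm{Des}(I^\sim)=\{d\in\{1,\dots,n-1\} : n-d\notin \mathrm{Des}(I)\}$. There is a unique series $g=\sum_{n\ge0}g_n$ with $g_n\in\mathbf{Sym}_n$ and $g_0=1$ which solves the noncommutative Poincaré equation $$g(qA)=\sum_{n\ge 0}S_n(A)\,g(A)^{n+1},\qquad\text{where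 } g(A)=\sum_n g_n,\quad g(qA)=\sum_n q^n g_n .$$ Let $\tilde g_n=(q)_n\,g_n$ with $(q)_n=(q^n-1)(q^{n-1}-1)\cdots(q-1)$. The decreasing tree of a word without repeated letters $w=umv$ with maximal letter $m$ is the binary tree with root $m$ whose left and right subtrees are the decreasing trees of $u$ and $v$ (the empty word has the empty tree). Two permutations $\sigma,\tau\in\mathfrak S_n$ are sylvester-equivalent if the decreasing trees of $\sigma^{-1}$ and $\tau^{-1}$ have the same shape. Each sylvester class contains exactly one permutation with the smallest number of inversions, called the top of the class. For $\sigma\in\mathfrak S_n$ and a composition $I$ of $n$, let $\alpha$ be the top of the sylvester class of $\sigma$, let $D=\mathrm{Des}(I^\sim)$, and set $$C_I(\sigma)=q^{\mathrm{inv}(\sigma)-\mathrm{inv}(\alpha)}\,q^{\mathrm{inv}(\alpha,D)},$$ where $\mathrm{inv}$ is the number of inversions and $\mathrm{inv}(\alpha,D)$ is the number of pairs $1\le i<j\le n$ with $\alpha_i>\alpha_j$ and $j-1\in D$. Then, for every $n\ge 0$, $$\tilde g_n=\sum_{I\vDash n}\Bigl(\sum_{\sigma\in\mathfrak S_n}C_I(\sigma)\Bigr)R_I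 .$$ In particular the coefficients of $\tilde g_n$ on the ribbon basis are values at $q$ of polynomials $\sum_{\sigma}C_I(\sigma)$ with coefficients in $\mathbb N$ (which do not depend on $K$), and these polynomials are $q$-analogues of $n!$: each takes the value $n!$ at $q=1$. -/

import Mathlib

namespace RibbonPoincare

/-! ### Noncommutative symmetric functions -/

section Sym

variable (K : Type*) [Field K]

/-- The algebra `Sym` of noncommutative symmetric functions over `K`: the free associative algebra
on generators `S_1, S_2, …`. -/
abbrev NCSym : Type _ := FreeAlgebra K ℕ+

/-- The complete function `S_n`, with `S_0 = 1`. -/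
noncomputable def completeS : ℕ → NCSym K
  | 0 => 1
  | n + 1 => FreeAlgebra.ι K n.succPNat

/-- `S^I = S_{i_1} S_{i_2} ⋯ S_{i_r}` for a composition `I = (i_1, …, i_r)` of `n`. -/
noncomputable def completeProd {n : ℕ} (I : Composition n) : NCSym K :=
  (I.blocks.map (completeS K)).prod

/-- The homogeneous component of degree `n` of `Sym`, where `S_k` has degree `k`. -/
noncomputable def homogeneousPart (n : ℕ) : Submodule K (NCSym K) :=
  Submodule.span K (Set.range fun I : Composition n => completeProd K I)

end Sym

/-! ### Compositions -/

/-- The descent set `{i_1, i_1 + i_2, …, i_1 + ⋯ + i_{r-1}}` of `I = (i_1, …, i_r)`; it is a subset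
of `{1, …, n-1}`. -/
def descentSet {n : ℕ} (I : Composition n) : Finset ℕ :=
  (Finset.Ico 1 I.length).image I.sizeUpTo

/-- The conjugate composition (transpose of the ribbon diagram). It is the composition with descent
set `{d ∈ {1, …, n-1} | n - d ∉ Des(I)}`; the equivalence used encodes `d` as `d - 1 : Fin (n - 1)`. -/
def conjugate {n : ℕ} (I : Composition n) : Composition n :=
  (compositionEquiv n).symm ((compositionAsSetEquiv n).symm
    (Finset.univ.filter fun i : Fin (n - 1) => n - ((i : ℕ) + 1) ∉ descentSet I))

/-- The ribbon function `R_I = ∑_J (-1)^{ℓ(I) - ℓ(J)} S^J`, summed over all compositions `J` that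
are coarser than or equal to `I`. -/
noncomputable def ribbon (K : Type*) [Field K] {n : ℕ} (I : Composition n) : NCSym K :=
  ∑ J ∈ Finset.univ.filter (fun J : Composition n => descentSet J ⊆ descentSet I),
    (-1 : K) ^ (I.length - J.length) • completeProd K J

/-! ### The noncommutative Poincaré equation -/

/-- A formal series `g = ∑_n g_n` with `g_n` homogeneous of degree `n` (an element of the
completion of `Sym`) is encoded by its components. With the homogeneity parameter `t` it is the
power series `g(tA) = ∑_n t^n g_n`. -/
noncomputable def gradedSeries {K : Type*} [Field K] (g : ℕ → NCSym K) : PowerSeries (NCSym K) :=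
  PowerSeries.mk g

/-- The sum `∑_{n ≥ 0} t^n S_n(A) g(tA)^{n+1}`: since the `n`-th term is divisible by `t^n`, only
the terms with `n ≤ m` contribute to the coefficient of `t^m`. -/
noncomputable def poincareRHS {K : Type*} [Field K] (g : ℕ → NCSym K) : PowerSeries (NCSym K) :=
  PowerSeries.mk fun m => ∑ n ∈ Finset.range (m + 1),
    PowerSeries.coeff m
      (PowerSeries.X ^ n * PowerSeries.C (completeS K n) * gradedSeries g ^ (n + 1))

/-- `g = ∑_n g_n` is a solution, with `g_0 = 1`, of the noncommutative Poincaré equation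
`g(qA) = ∑_{n ≥ 0} S_n(A) g(A)^{n+1}`; here `g(qA) = ∑_n q^n g_n`. -/
structure IsPoincareSolution {K : Type*} [Field K] (q : K) (g : ℕ → NCSym K) : Prop where
  homogeneous : ∀ n, g n ∈ homogeneousPart K n
  zero : g 0 = 1
  equation : gradedSeries (fun n => q ^ n • g n) = poincareRHS g

/-- `(q)_n = (q^n - 1)(q^{n-1} - 1) ⋯ (q - 1)`. -/
def qProd {K : Type*} [Field K] (q : K) (n : ℕ) : K :=
  ∏ i ∈ Finset.range n, (q ^ (i + 1) - 1)

/-! ### Permutations and sylvester classes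

A permutation `σ : Equiv.Perm (Fin n)` is identified with the word `σ 0, σ 1, …, σ (n-1)`. -/

/-- The largest letter of the nonempty word `a :: w`. -/
def maxLetter (a : ℕ) (w : List ℕ) : ℕ := w.foldr max a

theorem maxLetter_mem (a : ℕ) (w : List ℕ) : maxLetter a w ∈ a :: w := by
  induction w with
  | nil => simp [maxLetter]
  | cons b w ih =>
    simp only [maxLetter, List.foldr_cons, List.mem_cons] at ih ⊢
    rcases max_choice b (w.foldr max a) with h | h <;> rw [h]
    · simp
    · rcases ih with h' | h'
      · exact Or.inl h'
      · exact Or.inr (Or.inr h')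

/-- The decreasing tree of a word `w = u m v` without repeated letters and with maximal letter `m`:
the root is `m`, and the left and right subtrees are the decreasing trees of `u` and `v`. -/
def decreasingTree : List ℕ → BinaryTree ℕ
  | [] => BinaryTree.nil
  | a :: w =>
    BinaryTree.node (maxLetter a w)
      (decreasingTree ((a :: w).takeWhile (· < maxLetter a w)))
      (decreasingTree ((a :: w).dropWhile (· < maxLetter a w)).tail)
termination_by w => w.length
decreasing_by
  · refine lt_of_le_of_ne (List.takeWhile_sublist _).length_le fun h => ?_
    have hm := maxLetter_mem a w
    have hall := (List.takeWhile_sublist (fun x => decide (x < maxLetter a w))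
      (l := a :: w)).eq_of_length h
    rw [← hall] at hm
    simpa using List.mem_takeWhile_imp hm
  · have h := (List.dropWhile_sublist (fun x => decide (x < maxLetter a w))
      (l := a :: w)).length_le
    simp only [List.length_tail, List.length_cons] at h ⊢
    omega

/-- The shape of the decreasing tree of `σ⁻¹`. -/
def sylvesterShape {n : ℕ} (σ : Equiv.Perm (Fin n)) : BinaryTree Unit :=
  (decreasingTree (List.ofFn fun i : Fin n => ((σ⁻¹ i : Fin n) : ℕ))).map fun _ => ()

/-- Sylvester equivalence of permutations. -/
def SylvesterEquiv {n : ℕ} (σ τ : Equiv.Perm (Fin n)) : Prop :=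
  sylvesterShape σ = sylvesterShape τ

/-- The number of inversions `inv(σ)`. -/
def inv {n : ℕ} (σ : Equiv.Perm (Fin n)) : ℕ :=
  (Finset.univ.filter fun p : Fin n × Fin n => p.1 < p.2 ∧ σ p.2 < σ p.1).card

/-- `inv(α, D)`: the number of inversions `i < j`, `α_i > α_j`, whose right position, counted
from `0`, belongs to `D`; with positions counted from `1` the condition is `j - 1 ∈ D`. -/
def invAt {n : ℕ} (α : Equiv.Perm (Fin n)) (D : Finset ℕ) : ℕ :=
  (Finset.univ.filter fun p : Fin n × Fin n =>
    p.1 < p.2 ∧ α p.2 < α p.1 ∧ (p.2 : ℕ) ∈ D).card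

/-- `α` is a permutation with the smallest number of inversions in the sylvester class of `σ`. -/
def IsSylvesterTop {n : ℕ} (α σ : Equiv.Perm (Fin n)) : Prop :=
  SylvesterEquiv α σ ∧ ∀ τ, SylvesterEquiv τ σ → inv α ≤ inv τ

theorem exists_isSylvesterTop {n : ℕ} (σ : Equiv.Perm (Fin n)) : ∃ α, IsSylvesterTop α σ := by
  classical
  obtain ⟨α, hα, hmin⟩ := Finset.exists_min_image
    (Finset.univ.filter fun τ : Equiv.Perm (Fin n) => SylvesterEquiv τ σ) inv
    ⟨σ, Finset.mem_filter.mpr ⟨Finset.mem_univ σ, rfl⟩⟩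
  exact ⟨α, by simpa using hα, fun τ hτ => hmin τ (by simpa using hτ)⟩

/-- The top of the sylvester class of `σ`. -/
noncomputable def sylvesterTop {n : ℕ} (σ : Equiv.Perm (Fin n)) : Equiv.Perm (Fin n) :=
  (exists_isSylvesterTop σ).choose

/-- `C_I(σ) = q^{inv(σ) - inv(α)} q^{inv(α, D)}`, a monomial in `ℕ[q]`, where `α` is the top of the
sylvester class of `σ` and `D` is the descent set of the conjugate of `I`. The difference of
inversion numbers is nonnegative because `α` minimizes `inv`. -/
noncomputable def ribbonStat {n : ℕ} (I : Composition n) (σ : Equiv.Perm (Fin n)) :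
    Polynomial ℕ :=
  Polynomial.X ^ (inv σ - inv (sylvesterTop σ)) *
    Polynomial.X ^ invAt (sylvesterTop σ) (descentSet (conjugate I))

end RibbonPoincare

namespace RibbonPoincare

/-! ### Inversions of words and decreasing trees -/

/-! Both sides of the expansion satisfy the same quadratic recursion, one algebraically and the
other by cutting permutations at their largest letter.

Algebra. Put T = g(qA) - g(A); the equation says T = ∑_{n≥1} S_n g^{n+1}. Let Ω be the linear map
S_a X ↦ S_{a+1} X. Then T = S_1 g² + Ω(T g), and Ω commutes with right multiplication on T, which
has no constant term, so T = (S_1 g + Ω T) g. After multiplication by the factors (q)_n this becomes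
g̃_{m+1} = ∑_k [m choose k]_q (S_1 g̃_k + (q^k - 1) Ω g̃_k) g̃_{m-k}. Encode a ribbon by its descent
word w. Then S_1 R_w = R_{true::w} + R_{false::w} and Ω R_w = R_{false::w}, so the bracket only
produces the coefficients 1 and q^k; and R_u R_v is the sum of the two ways to glue u and v. Reading
off the coefficient of R_w gives the recursion `descentPoly` (`ribbonSum_succ`).

Combinatorics. Write the word of σ⁻¹ as u m v with m maximal. Inversions of σ become pairs whose
larger letter, the right position in σ, stands on the left. The minimum of inv over words with a
given tree shape is reached exactly when, at every node, the letters of the left subtree lie below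
those of the right one (`isSylvesterTop_iff`). Hence inv(σ) - inv(α) counts the inversions between u
and v over all nodes. For |v| = k, summing over the set of letters of v yields a Gaussian binomial,
while the root adds k to inv(α, D) when its letter in α lies in D. This is again `descentPoly`
(`sum_arrangements_wordExponent`), since conjugation of I turns D into the descent word of I. -/

/-- The number of inversions of a word whose larger (left) letter satisfies `D`. -/
def wordInv (D : ℕ → Bool) : List ℕ → ℕ
  | [] => 0
  | a :: l => (if D a then l.countP (· < a) else 0) + wordInv D l

/-- The number of inversions between two words whose larger (left) letter satisfies `D`. -/
def crossInv (D : ℕ → Bool) (u v : List ℕ) : ℕ :=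
  (u.map fun a => if D a then v.countP (· < a) else 0).sum

theorem wordInv_append (D : ℕ → Bool) (u v : List ℕ) :
    wordInv D (u ++ v) = wordInv D u + wordInv D v + crossInv D u v := by
  induction u with
  | nil => simp [wordInv, crossInv]
  | cons a u ih =>
    simp only [List.cons_append, wordInv, ih, crossInv, List.map_cons, List.sum_cons,
      List.countP_append]
    split_ifs <;> omega

theorem crossInv_eq_zero (D : ℕ → Bool) {u v : List ℕ} (h : ∀ a ∈ u, ∀ b ∈ v, a ≤ b) :
    crossInv D u v = 0 := by
  rw [crossInv, List.sum_eq_zero]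
  simp only [List.mem_map]
  rintro _ ⟨a, ha, rfl⟩
  split_ifs with hD
  · rw [List.countP_eq_zero]
    intro b hb
    have := h a ha b hb
    simpa using this
  · rfl

theorem crossInv_true_eq_zero_iff {u v : List ℕ} :
    crossInv (fun _ => true) u v = 0 ↔ ∀ a ∈ u, ∀ b ∈ v, a ≤ b := by
  refine ⟨fun h a ha b hb => ?_, crossInv_eq_zero _⟩
  simp only [crossInv, if_true, List.sum_eq_zero_iff_forall_eq_nat, List.mem_map,
    forall_exists_index, and_imp, forall_apply_eq_imp_iff₂, List.countP_eq_zero] at h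
  simpa using h a ha b hb

theorem wordInv_split (D : ℕ → Bool) {u v : List ℕ} {m : ℕ} (hu : ∀ a ∈ u, a < m)
    (hv : ∀ a ∈ v, a < m) :
    wordInv D (u ++ m :: v) =
      wordInv D u + wordInv D v + crossInv D u v + if D m then v.length else 0 := by
  have h1 : v.countP (· < m) = v.length := by
    rw [List.countP_eq_length]; simpa using hv
  have h2 : crossInv D u (m :: v) = crossInv D u v := by
    unfold crossInv
    congr 1
    refine List.map_congr_left fun a ha => ?_
    have := hu a ha
    rw [List.countP_cons_of_neg (by simpa using this.le)]
  rw [wordInv_append, h2, wordInv, h1]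
  omega

theorem maxLetter_eq {a m : ℕ} {w : List ℕ} (hm : m ∈ a :: w) (h : ∀ x ∈ a :: w, x ≤ m) :
    maxLetter a w = m := by
  refine le_antisymm (h _ (maxLetter_mem a w)) ?_
  have key : ∀ (w : List ℕ), ∀ x ∈ a :: w, x ≤ maxLetter a w := by
    intro w
    induction w with
    | nil => simp [maxLetter]
    | cons b w ih =>
      intro x hx
      simp only [maxLetter, List.foldr_cons, List.mem_cons, le_max_iff] at ih hx ⊢
      rcases hx with rfl | rfl | hx
      · exact Or.inr (ih _ (Or.inl rfl))
      · exact Or.inl le_rfl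
      · exact Or.inr (ih _ (Or.inr hx))
  exact key w m hm

theorem decreasingTree_split {u v : List ℕ} {m : ℕ} (hu : ∀ a ∈ u, a < m)
    (hv : ∀ a ∈ v, a < m) :
    decreasingTree (u ++ m :: v) =
      BinaryTree.node m (decreasingTree u) (decreasingTree v) := by
  obtain ⟨a, w, haw⟩ : ∃ a w, u ++ m :: v = a :: w := by
    cases u with
    | nil => exact ⟨m, v, rfl⟩
    | cons a u => exact ⟨a, u ++ m :: v, rfl⟩
  have hmax : maxLetter a w = m := by
    apply maxLetter_eq <;> rw [← haw]
    · simp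
    · intro x hx
      simp only [List.mem_append, List.mem_cons] at hx
      rcases hx with hx | rfl | hx
      · exact (hu x hx).le
      · exact le_rfl
      · exact (hv x hx).le
  rw [haw, decreasingTree, hmax, ← haw]
  have hu' : ∀ a ∈ u, decide (a < m) = true := by simpa using hu
  rw [List.takeWhile_append_of_pos hu', List.dropWhile_append_of_pos hu']
  simp

/-- The shape of the decreasing tree of a word. -/
def wordShape (l : List ℕ) : BinaryTree Unit := (decreasingTree l).map fun _ => ()

theorem wordShape_nil : wordShape [] = BinaryTree.nil := by
  rw [wordShape, decreasingTree, BinaryTree.map]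

theorem wordShape_split {u v : List ℕ} {m : ℕ} (hu : ∀ a ∈ u, a < m)
    (hv : ∀ a ∈ v, a < m) :
    wordShape (u ++ m :: v) = BinaryTree.node () (wordShape u) (wordShape v) := by
  rw [wordShape, decreasingTree_split hu hv, BinaryTree.map]; rfl

/-- Induction on words without repeated letters, splitting at the largest letter. -/
theorem splitInduction {P : List ℕ → Prop} (nil : P [])
    (split : ∀ (u v : List ℕ) (m : ℕ), (∀ a ∈ u, a < m) → (∀ a ∈ v, a < m) →
      (u ++ m :: v).Nodup → P u → P v → P (u ++ m :: v)) :
    ∀ l : List ℕ, l.Nodup → P l := by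
  intro l
  induction hn : l.length using Nat.strong_induction_on generalizing l with
  | _ n ih =>
  intro hl
  rcases l.eq_nil_or_concat with rfl | ⟨_, _, hne⟩
  · exact nil
  have hne : l ≠ [] := by rw [hne]; simp
  obtain ⟨m, hm, hmax⟩ := l.toFinset.exists_max_image id (by simpa using hne)
  simp only [List.mem_toFinset, id] at hm hmax
  obtain ⟨u, v, rfl⟩ := List.append_of_mem hm
  have hl' := hl
  rw [List.nodup_append] at hl'
  obtain ⟨hu, hv, huv⟩ := hl'
  rw [List.nodup_cons] at hv
  have h1 : ∀ a ∈ u, a < m := fun a ha =>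
    lt_of_le_of_ne (hmax a (by simp [ha])) (huv a ha m (by simp))
  have h2 : ∀ a ∈ v, a < m := fun a ha =>
    lt_of_le_of_ne (hmax a (by simp [ha])) (by rintro rfl; exact hv.1 ha)
  simp only [List.length_append, List.length_cons] at hn
  exact split u v m h1 h2 hl (ih _ (by omega) u rfl hu) (ih _ (by omega) v rfl hv.2)

theorem numNodes_wordShape : ∀ l : List ℕ, l.Nodup → (wordShape l).numNodes = l.length := by
  refine splitInduction (by simp [wordShape_nil]) fun u v m hu hv _ h1 h2 => ?_
  rw [wordShape_split hu hv, BinaryTree.numNodes, h1, h2]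
  simp; omega

/-- The number of inversions, with larger letter in `D`, of the word on the letters
`o, o + 1, …` with decreasing tree of shape `T` and as few inversions as possible. -/
def treeInv (D : ℕ → Bool) : BinaryTree Unit → ℕ → ℕ
  | .nil, _ => 0
  | .node _ L R, o => treeInv D L o + treeInv D R (o + L.numNodes) +
      if D (o + L.numNodes + R.numNodes) then R.numNodes else 0

/-- The word on the letters `o, o + 1, …` with decreasing tree of shape `T` and as few inversions
as possible. -/
def treeWord : BinaryTree Unit → ℕ → List ℕ
  | .nil, _ => []
  | .node _ L R, o =>
      treeWord L o ++ (o + L.numNodes + R.numNodes) :: treeWord R (o + L.numNodes)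

theorem length_treeWord (T : BinaryTree Unit) (o : ℕ) : (treeWord T o).length = T.numNodes := by
  induction T generalizing o with
  | nil => simp [treeWord]
  | node _ L R hL hR => simp [treeWord, hL, hR]; omega

theorem mem_treeWord {T : BinaryTree Unit} {o a : ℕ} :
    a ∈ treeWord T o ↔ o ≤ a ∧ a < o + T.numNodes := by
  induction T generalizing o a with
  | nil => simp [treeWord]
  | node _ L R hL hR => simp [treeWord, hL, hR]; omega

theorem nodup_treeWord (T : BinaryTree Unit) (o : ℕ) : (treeWord T o).Nodup := by
  induction T generalizing o with
  | nil => simp [treeWord]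
  | node _ L R hL hR =>
    simp only [treeWord, List.nodup_append, List.nodup_cons, hL, hR, List.mem_cons, mem_treeWord]
    refine ⟨trivial, ⟨by omega, trivial⟩, ?_⟩
    rintro a ha b (rfl | hb) <;> omega

theorem treeWord_lt_left {L R : BinaryTree Unit} {o : ℕ} :
    ∀ a ∈ treeWord L o, a < o + L.numNodes + R.numNodes := by
  simp only [mem_treeWord]; omega

theorem treeWord_lt_right {L R : BinaryTree Unit} {o : ℕ} :
    ∀ a ∈ treeWord R (o + L.numNodes), a < o + L.numNodes + R.numNodes := by
  simp only [mem_treeWord]; omega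

theorem wordShape_treeWord (T : BinaryTree Unit) (o : ℕ) : wordShape (treeWord T o) = T := by
  induction T generalizing o with
  | nil => simp [treeWord, wordShape_nil]
  | node _ L R hL hR =>
    rw [treeWord, wordShape_split treeWord_lt_left treeWord_lt_right, hL, hR]

theorem wordInv_treeWord (D : ℕ → Bool) (T : BinaryTree Unit) (o : ℕ) :
    wordInv D (treeWord T o) = treeInv D T o := by
  induction T generalizing o with
  | nil => rfl
  | node _ L R hL hR =>
    rw [treeWord, wordInv_split D treeWord_lt_left treeWord_lt_right, hL, hR, treeInv,
      crossInv_eq_zero, length_treeWord, add_zero]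
    simp only [mem_treeWord]; omega

theorem treeInv_true (T : BinaryTree Unit) (o : ℕ) :
    treeInv (fun _ => true) T o = treeInv (fun _ => true) T 0 := by
  induction T generalizing o with
  | nil => rfl
  | node _ L R hL hR =>
    simp only [treeInv]
    rw [hL, hR, hR (0 + L.numNodes)]

/-- The least number of inversions of a word with decreasing tree of shape `T`. -/
def minInv (T : BinaryTree Unit) : ℕ := treeInv (fun _ => true) T 0

theorem minInv_node (L R : BinaryTree Unit) :
    minInv (.node () L R) = minInv L + minInv R + R.numNodes := by
  simp [minInv, treeInv, treeInv_true R L.numNodes]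

/-- Cutting at the maximum, `wordInv` and `minInv` obey the same recursion except for the
nonnegative term `crossInv u v`. -/
theorem minInv_wordShape_le : ∀ l : List ℕ, l.Nodup →
    minInv (wordShape l) ≤ wordInv (fun _ => true) l := by
  refine splitInduction (by simp [wordShape_nil, minInv, treeInv]) fun u v m hu hv h h1 h2 => ?_
  rw [wordShape_split hu hv, wordInv_split _ hu hv, minInv_node, numNodes_wordShape v]
  · simp; omega
  · exact (List.nodup_cons.mp (List.nodup_append.mp h).2.1).2

/-- Equality in `minInv_wordShape_le` forces every cross term to vanish, so at each node the letters
of `u` precede those of `v`. As the alphabet is an interval, both letter sets are then intervals,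
and the word is determined by its shape. -/
theorem eq_treeWord_of_wordInv_eq : ∀ l : List ℕ, l.Nodup → ∀ o : ℕ,
    (∀ a, a ∈ l ↔ o ≤ a ∧ a < o + l.length) →
    wordInv (fun _ => true) l = minInv (wordShape l) → l = treeWord (wordShape l) o := by
  refine splitInduction (by simp [wordShape_nil, treeWord]) fun u v m hu hv h h1 h2 o hl hi => ?_
  have hn := List.nodup_append.mp h
  have hnu := hn.1
  have hnv := (List.nodup_cons.mp hn.2.1).2
  rw [wordShape_split hu hv, wordInv_split _ hu hv, minInv_node, numNodes_wordShape v hnv] at hi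
  have hu1 := minInv_wordShape_le u hnu
  have hv1 := minInv_wordShape_le v hnv
  simp only [if_true] at hi
  have hc : crossInv (fun _ => true) u v = 0 := by omega
  rw [crossInv_true_eq_zero_iff] at hc
  have hlen : (u ++ m :: v).length = u.length + v.length + 1 := by simp; omega
  rw [hlen] at hl
  have hm : m = o + u.length + v.length := by
    have h3 := (hl m).mp (by simp)
    have h4 := (hl (o + u.length + v.length)).mpr (by omega)
    simp only [List.mem_append, List.mem_cons] at h4
    rcases h4 with h4 | h4 | h4
    · have := hu _ h4; omega
    · omega
    · have := hv _ h4; omega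
  have hlt : ∀ a ∈ u, ∀ b ∈ v, a < b := fun a ha b hb =>
    lt_of_le_of_ne (hc a ha b hb) (hn.2.2 a ha b (by simp [hb]))
  have hmem : ∀ a, o ≤ a → a < m → a ∈ u ∨ a ∈ v := fun a h3 h4 => by
    have := (hl a).mpr (by omega)
    simp only [List.mem_append, List.mem_cons] at this
    rcases this with h | h | h
    · exact Or.inl h
    · omega
    · exact Or.inr h
  have huo : ∀ a ∈ u, o ≤ a := fun a ha => ((hl a).mp (by simp [ha])).1
  have hvo : ∀ a ∈ v, o ≤ a := fun a ha => ((hl a).mp (by simp [ha])).1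
  have hub : ∀ a ∈ u, a < o + u.length := by
    intro a ha
    by_contra hcon
    -- A letter of `u` that is too large would force a whole interval of more than `u.length`
    -- letters into `u`; the bound for `v` below is symmetric.
    have hsub : Finset.Icc o a ⊆ u.toFinset := by
      intro x hx
      rw [Finset.mem_Icc] at hx
      rw [List.mem_toFinset]
      rcases hmem x hx.1 (lt_of_le_of_lt hx.2 (hu a ha)) with h | h
      · exact h
      · have := hlt a ha x h; omega
    have := Finset.card_le_card hsub
    rw [List.toFinset_card_of_nodup hnu, Nat.card_Icc] at this
    omega
  have hvb : ∀ a ∈ v, o + u.length ≤ a := by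
    intro a ha
    by_contra hcon
    have hsub : Finset.Ico a m ⊆ v.toFinset := by
      intro x hx
      rw [Finset.mem_Ico] at hx
      rw [List.mem_toFinset]
      rcases hmem x (le_trans (hvo a ha) hx.1) hx.2 with h | h
      · have := hlt x h a ha; omega
      · exact h
    have := Finset.card_le_card hsub
    rw [List.toFinset_card_of_nodup hnv, Nat.card_Ico] at this
    omega
  rw [wordShape_split hu hv, treeWord, numNodes_wordShape u hnu, numNodes_wordShape v hnv, ← hm]
  rw [← h1 o _ (by omega), ← h2 (o + u.length) _ (by omega)]
  · intro a
    refine ⟨fun ha => ⟨hvb a ha, by have := hv a ha; omega⟩, fun ha => ?_⟩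
    rcases hmem a (by omega) (by omega) with h | h
    · have := hub a h; omega
    · exact h
  · intro a
    refine ⟨fun ha => ⟨huo a ha, hub a ha⟩, fun ha => ?_⟩
    rcases hmem a (by omega) (by omega) with h | h
    · exact h
    · have := hvb a h; omega

/-! ### The inverse of a permutation as a word -/

/-- The word of `σ⁻¹`. -/
def invWord {n : ℕ} (σ : Equiv.Perm (Fin n)) : List ℕ :=
  List.ofFn fun i : Fin n => ((σ⁻¹ i : Fin n) : ℕ)

theorem sylvesterShape_eq {n : ℕ} (σ : Equiv.Perm (Fin n)) :
    sylvesterShape σ = wordShape (invWord σ) := rfl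

theorem length_invWord {n : ℕ} (σ : Equiv.Perm (Fin n)) : (invWord σ).length = n := by
  simp [invWord]

theorem nodup_invWord {n : ℕ} (σ : Equiv.Perm (Fin n)) : (invWord σ).Nodup := by
  rw [invWord, List.nodup_ofFn]
  exact Fin.val_injective.comp (σ⁻¹).injective

theorem mem_invWord {n : ℕ} {σ : Equiv.Perm (Fin n)} {a : ℕ} : a ∈ invWord σ ↔ a < n := by
  rw [invWord, List.mem_ofFn']
  constructor
  · rintro ⟨i, rfl⟩; exact (σ⁻¹ i).isLt
  · intro h; exact ⟨σ ⟨a, h⟩, by simp⟩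

theorem invWord_injective {n : ℕ} : Function.Injective (invWord (n := n)) := by
  intro σ τ h
  have h1 := List.ofFn_injective h
  refine inv_injective (Equiv.ext fun i => Fin.ext (congrFun h1 i))

theorem exists_invWord {n : ℕ} {l : List ℕ} (hl : l.Nodup) (hn : l.length = n)
    (hlt : ∀ a ∈ l, a < n) : ∃ σ : Equiv.Perm (Fin n), invWord σ = l := by
  subst hn
  have hinj : Function.Injective fun i : Fin l.length =>
      (⟨l.get i, hlt _ (List.get_mem l i)⟩ : Fin l.length) := by
    intro i j h
    simp only [Fin.mk.injEq] at h
    exact (List.nodup_iff_injective_get.mp hl) h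
  refine ⟨(Equiv.ofBijective _ (Finite.injective_iff_bijective.mp hinj))⁻¹, ?_⟩
  simp only [invWord, inv_inv, Equiv.ofBijective_apply]
  exact List.ofFn_get l

theorem wordInv_ofFn (D : ℕ → Bool) {n : ℕ} (f : Fin n → ℕ) :
    wordInv D (List.ofFn f) =
      ∑ i : Fin n, ∑ j : Fin n, if i < j ∧ f j < f i ∧ D (f i) = true then 1 else 0 := by
  induction n with
  | zero => simp [wordInv]
  | succ n ih =>
    rw [List.ofFn_succ, wordInv, ih, Fin.sum_univ_succ]
    congr 1
    · rw [Fin.sum_univ_succ]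
      simp only [lt_self_iff_false, false_and, if_false, zero_add, Fin.succ_pos, true_and]
      by_cases hD : D (f 0) = true
      · simp only [hD, if_true, and_true]
        clear ih
        generalize f 0 = a
        generalize hg : (fun i : Fin n => f i.succ) = g
        have : ∀ i : Fin n, f i.succ = g i := fun i => congrFun hg i
        simp only [this]
        clear this hg f hD
        induction n with
        | zero => simp
        | succ n ih =>
          rw [List.ofFn_succ, List.countP_cons, ih, Fin.sum_univ_succ, add_comm]
          simp
      · simp [hD]
    · refine Finset.sum_congr rfl fun i _ => ?_
      rw [Fin.sum_univ_succ]
      simp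

/-- Inversion exchanges positions and values: the right position of an inversion of `σ` becomes the
larger letter, standing on the left, in the word of `σ⁻¹`. This is why `wordInv` tests `D` on the
left letter. -/
theorem card_inversions {n : ℕ} (σ : Equiv.Perm (Fin n)) (D : ℕ → Bool) :
    (Finset.univ.filter fun p : Fin n × Fin n =>
      p.1 < p.2 ∧ σ p.2 < σ p.1 ∧ D p.2 = true).card = wordInv D (invWord σ) := by
  rw [invWord, wordInv_ofFn, Finset.card_filter, ← Finset.univ_product_univ, Finset.sum_product,
    Finset.sum_comm, ← Equiv.sum_comp σ⁻¹]
  refine Finset.sum_congr rfl fun i _ => ?_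
  rw [← Equiv.sum_comp σ⁻¹]
  refine Finset.sum_congr rfl fun j _ => ?_
  have h : ∀ k, σ (σ⁻¹ k) = k := σ.apply_symm_apply
  simp only [h, Fin.val_fin_lt]
  congr 1
  simp only [eq_iff_iff]
  tauto

theorem inv_eq_wordInv {n : ℕ} (σ : Equiv.Perm (Fin n)) :
    inv σ = wordInv (fun _ => true) (invWord σ) := by
  rw [← card_inversions]; simp [inv]

theorem invAt_eq_wordInv {n : ℕ} (σ : Equiv.Perm (Fin n)) (D : Finset ℕ) :
    invAt σ D = wordInv (fun d => decide (d ∈ D)) (invWord σ) := by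
  rw [← card_inversions]; simp [invAt]

theorem exists_invWord_eq_treeWord {n : ℕ} (σ : Equiv.Perm (Fin n)) :
    ∃ τ : Equiv.Perm (Fin n), invWord τ = treeWord (sylvesterShape σ) 0 := by
  have h : (sylvesterShape σ).numNodes = n := by
    rw [sylvesterShape_eq, numNodes_wordShape _ (nodup_invWord σ), length_invWord]
  refine exists_invWord (nodup_treeWord _ _) (by rw [length_treeWord, h]) fun a ha => ?_
  rw [mem_treeWord, h] at ha
  omega

theorem isSylvesterTop_iff {n : ℕ} {α σ : Equiv.Perm (Fin n)} :
    IsSylvesterTop α σ ↔ invWord α = treeWord (sylvesterShape σ) 0 := by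
  constructor
  · rintro ⟨h1, h2⟩
    obtain ⟨τ, hτ⟩ := exists_invWord_eq_treeWord σ
    have h3 := h2 τ (by rw [SylvesterEquiv, sylvesterShape_eq, hτ, wordShape_treeWord])
    rw [inv_eq_wordInv, inv_eq_wordInv, hτ, wordInv_treeWord] at h3
    have h4 := minInv_wordShape_le _ (nodup_invWord α)
    rw [← sylvesterShape_eq, h1, minInv] at h4
    have h5 := eq_treeWord_of_wordInv_eq _ (nodup_invWord α) 0
      (by simp [mem_invWord, length_invWord])
    rw [← sylvesterShape_eq, h1, minInv] at h5
    exact h5 (le_antisymm h3 h4)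
  · intro h
    refine ⟨by rw [SylvesterEquiv, sylvesterShape_eq, h, wordShape_treeWord], fun τ hτ => ?_⟩
    rw [inv_eq_wordInv, inv_eq_wordInv, h, wordInv_treeWord, ← hτ]
    exact minInv_wordShape_le _ (nodup_invWord τ)

theorem existsUnique_isSylvesterTop {n : ℕ} (σ : Equiv.Perm (Fin n)) :
    ∃! α, IsSylvesterTop α σ := by
  obtain ⟨α, hα⟩ := exists_invWord_eq_treeWord σ
  refine ⟨α, isSylvesterTop_iff.mpr hα, fun β hβ => invWord_injective ?_⟩
  rw [hα, isSylvesterTop_iff.mp hβ]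

/-- The exponent of the monomial attached to a word. -/
def wordExponent (D : ℕ → Bool) (o : ℕ) (l : List ℕ) : ℕ :=
  wordInv (fun _ => true) l - minInv (wordShape l) + treeInv D (wordShape l) o

theorem ribbonStat_eq {n : ℕ} (I : Composition n) (σ : Equiv.Perm (Fin n)) :
    ribbonStat I σ = Polynomial.X ^
      wordExponent (fun d => decide (d ∈ descentSet (conjugate I))) 0 (invWord σ) := by
  have h := isSylvesterTop_iff.mp (exists_isSylvesterTop σ).choose_spec
  rw [ribbonStat, ← pow_add, sylvesterTop, inv_eq_wordInv, inv_eq_wordInv, invAt_eq_wordInv, h,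
    wordInv_treeWord, wordInv_treeWord]
  rfl

/-- The maximum contributes `v.length` to both `wordInv` and `minInv`, so only the cross inversions
survive in the difference. The truncated subtractions are genuine by `minInv_wordShape_le`. -/
theorem wordExponent_split {D : ℕ → Bool} {o : ℕ} {u v : List ℕ} {m : ℕ}
    (hu : ∀ a ∈ u, a < m) (hv : ∀ a ∈ v, a < m) (hnu : u.Nodup) (hnv : v.Nodup) :
    wordExponent D o (u ++ m :: v) =
      crossInv (fun _ => true) u v + (if D (o + u.length + v.length) then v.length else 0) +
        wordExponent D o u + wordExponent D (o + u.length) v := by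
  have h1 := minInv_wordShape_le u hnu
  have h2 := minInv_wordShape_le v hnv
  simp only [wordExponent, wordShape_split hu hv, wordInv_split _ hu hv, minInv_node, treeInv,
    numNodes_wordShape u hnu, numNodes_wordShape v hnv, if_true]
  omega

open Polynomial

/-! ### Gaussian binomial coefficients -/

/-- The Gaussian binomial coefficient as a polynomial. -/
noncomputable def gaussBinom : ℕ → ℕ → ℕ[X]
  | _, 0 => 1
  | 0, _ + 1 => 0
  | n + 1, k + 1 => X ^ (k + 1) * gaussBinom n (k + 1) + gaussBinom n k

theorem gaussBinom_eq_zero {n k : ℕ} (h : n < k) : gaussBinom n k = 0 := by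
  induction n generalizing k with
  | zero => obtain ⟨k, rfl⟩ := Nat.exists_eq_succ_of_ne_zero h.ne'; rfl
  | succ n ih =>
    obtain ⟨k, rfl⟩ := Nat.exists_eq_succ_of_ne_zero (Nat.ne_zero_of_lt h)
    rw [Nat.succ_eq_add_one, gaussBinom, ih (by omega), ih (by omega)]; simp

theorem qProd_succ {K : Type*} [Field K] (q : K) (n : ℕ) :
    qProd q (n + 1) = qProd q n * (q ^ (n + 1) - 1) := Finset.prod_range_succ _ _

theorem aeval_gaussBinom_mul {K : Type*} [Field K] (q : K) {n k : ℕ} (h : k ≤ n) :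
    aeval q (gaussBinom n k) * (qProd q k * qProd q (n - k)) = qProd q n := by
  induction n generalizing k with
  | zero => obtain rfl : k = 0 := by omega
            simp [gaussBinom, qProd]
  | succ n ih =>
    cases k with
    | zero => simp [gaussBinom, qProd]
    | succ k =>
      rw [gaussBinom, map_add, map_mul, map_pow, aeval_X, Nat.add_sub_add_right, qProd_succ q k,
        qProd_succ q n]
      have h1 := ih (k := k) (by omega)
      rcases (Nat.lt_or_ge k n) with hk | hk
      · have h2 := ih (k := k + 1) (by omega)
        obtain ⟨j, rfl⟩ : ∃ j, n = k + j + 1 := ⟨n - k - 1, by omega⟩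
        rw [show k + j + 1 - (k + 1) = j by omega, qProd_succ q k] at h2
        rw [show k + j + 1 - k = j + 1 by omega, qProd_succ q j] at *
        linear_combination (q ^ (k + 1)) * (q ^ (j + 1) - 1) * h2 + (q ^ (k + 1) - 1) * h1
      · obtain rfl : k = n := by omega
        rw [gaussBinom_eq_zero (Nat.lt_succ_self k), map_zero]
        linear_combination (q ^ (k + 1) - 1) * h1

/-- Induction on the largest element `a`: outside `C` it lies above all of `C` and contributes `X ^
C.card`; inside `C` it lies below nothing. These are the two terms of the q-Pascal rule. The weight
`f` is arbitrary because both cases modify it. -/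
theorem sum_powerset_crossings (f : ℕ → ℕ[X]) (A : Finset ℕ) :
    ∑ C ∈ A.powerset, X ^ (∑ b ∈ A \ C, (C.filter (· < b)).card) * f C.card =
      ∑ k ∈ Finset.range (A.card + 1), gaussBinom A.card k * f k := by
  induction A using Finset.induction_on_max generalizing f with
  | empty => simp [gaussBinom]
  | insert a A ha ih =>
    have haA : a ∉ A := fun h => lt_irrefl a (ha a h)
    rw [Finset.sum_powerset_insert haA]
    have h1 : ∀ C ∈ A.powerset,
        (X : ℕ[X]) ^ (∑ b ∈ insert a A \ C, (C.filter (· < b)).card) * f C.card =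
          X ^ (∑ b ∈ A \ C, (C.filter (· < b)).card) * (X ^ C.card * f C.card) := by
      intro C hC
      rw [Finset.mem_powerset] at hC
      rw [Finset.insert_sdiff_of_notMem _ fun h => haA (hC h), Finset.sum_insert (by simp [haA]),
        Finset.filter_true_of_mem fun c hc => ha c (hC hc), pow_add]
      ring
    have h2 : ∀ C ∈ A.powerset,
        (X : ℕ[X]) ^ (∑ b ∈ insert a A \ insert a C, ((insert a C).filter (· < b)).card) *
            f (insert a C).card =
          X ^ (∑ b ∈ A \ C, (C.filter (· < b)).card) * f (C.card + 1) := by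
      intro C hC
      rw [Finset.mem_powerset] at hC
      rw [Finset.card_insert_of_notMem fun h => haA (hC h), Finset.insert_sdiff_insert,
        Finset.sdiff_insert_of_notMem haA]
      congr 2
      refine Finset.sum_congr rfl fun b hb => ?_
      rw [Finset.filter_insert, if_neg]
      exact (ha b (Finset.mem_sdiff.mp hb).1).not_gt
    rw [Finset.sum_congr rfl h1, Finset.sum_congr rfl h2, ih fun k => X ^ k * f k,
      ih fun k => f (k + 1), Finset.card_insert_of_notMem haA,
      Finset.sum_range_succ' _ (A.card + 1), Finset.sum_range_succ' _ A.card]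
    simp only [gaussBinom, add_mul, Finset.sum_add_distrib]
    rw [Finset.sum_range_succ (fun k => X ^ (k + 1) * gaussBinom A.card (k + 1) * f (k + 1)),
      gaussBinom_eq_zero (Nat.lt_succ_self A.card)]
    simp only [pow_zero, mul_zero, zero_mul, add_zero]
    have : ∀ k, gaussBinom A.card (k + 1) * (X ^ (k + 1) * f (k + 1)) =
      X ^ (k + 1) * gaussBinom A.card (k + 1) * f (k + 1) := fun k => by ring
    simp only [this]
    ring

/-! ### Sums over the arrangements of an alphabet -/

/-- The words in which each letter of `A` occurs exactly once. -/
def arrangements (A : Finset ℕ) : Finset (List ℕ) := ⟨A.val.lists, Multiset.lists_nodup_finset A⟩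

theorem mem_arrangements' {A : Finset ℕ} {l : List ℕ} : l ∈ arrangements A ↔ A.val = l :=
  Multiset.mem_lists_iff _ _

theorem mem_arrangements {A : Finset ℕ} {l : List ℕ} :
    l ∈ arrangements A ↔ l.Nodup ∧ ∀ a, a ∈ l ↔ a ∈ A := by
  rw [mem_arrangements']
  constructor
  · intro h
    refine ⟨?_, fun a => ?_⟩
    · rw [← Multiset.coe_nodup, ← h]; exact A.nodup
    · rw [← Multiset.mem_coe, ← h]; rfl
  · rintro ⟨h1, h2⟩
    rw [Multiset.Nodup.ext A.nodup (Multiset.coe_nodup.mpr h1)]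
    intro a
    rw [Multiset.mem_coe, h2]; rfl

theorem length_of_mem_arrangements {A : Finset ℕ} {l : List ℕ} (h : l ∈ arrangements A) :
    l.length = A.card := by
  rw [mem_arrangements'] at h
  rw [Finset.card, h, Multiset.coe_card]

theorem crossInv_of_mem_arrangements {A B : Finset ℕ} {u v : List ℕ} (hu : u ∈ arrangements A)
    (hv : v ∈ arrangements B) :
    crossInv (fun _ => true) u v = ∑ a ∈ A, (B.filter (· < a)).card := by
  rw [mem_arrangements'] at hu hv
  rw [Finset.sum, hu, Multiset.map_coe, Multiset.sum_coe, crossInv]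
  congr 1
  refine List.map_congr_left fun a _ => ?_
  rw [Finset.card, Finset.filter_val, hv, ← Multiset.countP_eq_card_filter, Multiset.coe_countP]
  simp

theorem sum_arrangements {M : Type*} [AddCommMonoid M] (F : List ℕ → M) {A : Finset ℕ} {m : ℕ}
    (hm : m ∉ A) :
    ∑ l ∈ arrangements (insert m A), F l =
      ∑ C ∈ A.powerset, ∑ u ∈ arrangements (A \ C), ∑ v ∈ arrangements C, F (u ++ m :: v) := by
  simp only [← Finset.sum_product']
  rw [Finset.sum_sigma']
  symm
  refine Finset.sum_bij (fun x _ => x.2.1 ++ m :: x.2.2) ?_ ?_ ?_ ?_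
  · rintro ⟨C, u, v⟩ h
    simp only [Finset.mem_sigma, Finset.mem_powerset, Finset.mem_product, mem_arrangements,
      Finset.mem_sdiff] at h ⊢
    obtain ⟨hC, ⟨hu, hu'⟩, hv, hv'⟩ := h
    refine ⟨?_, fun a => ?_⟩
    · rw [List.nodup_append, List.nodup_cons]
      refine ⟨hu, ⟨fun h => hm (hC ((hv' m).mp h)), hv⟩, ?_⟩
      rintro a ha b hb rfl
      rw [hu'] at ha
      rw [List.mem_cons, hv'] at hb
      rcases hb with rfl | hb
      · exact hm ha.1
      · exact ha.2 hb
    · rw [List.mem_append, List.mem_cons, hu', hv', Finset.mem_insert]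
      have := @hC a
      tauto
  · rintro ⟨C, u, v⟩ h ⟨C', u', v'⟩ h' heq
    simp only [Finset.mem_sigma, Finset.mem_powerset, Finset.mem_product, mem_arrangements,
      Finset.mem_sdiff] at h h' heq
    obtain ⟨hC, ⟨hu, hu'⟩, hv, hv'⟩ := h
    obtain ⟨hC1, ⟨hu1, hu1'⟩, hv1, hv1'⟩ := h'
    have h3 := (List.append_cons_inj_of_notMem (fun h => hm ((hu' m).mp h).1)
      (fun h => hm (hC ((hv' m).mp h)))).mp heq
    obtain ⟨rfl, -, rfl⟩ := h3
    obtain rfl : C = C' := by ext a; rw [← hv', ← hv1']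
    rfl
  · intro l hl
    rw [mem_arrangements] at hl
    obtain ⟨hnd, hl⟩ := hl
    obtain ⟨u, v, rfl⟩ := List.append_of_mem ((hl m).mpr (Finset.mem_insert_self m A))
    rw [List.nodup_append, List.nodup_cons] at hnd
    obtain ⟨hu, ⟨hmv, hv⟩, huv⟩ := hnd
    simp only [List.mem_append, List.mem_cons, Finset.mem_insert] at hl huv
    refine ⟨⟨v.toFinset, u, v⟩, ?_, rfl⟩
    simp only [Finset.mem_sigma, Finset.mem_powerset, Finset.mem_product, mem_arrangements,
      Finset.mem_sdiff, List.mem_toFinset]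
    refine ⟨fun a ha => ?_, ⟨hu, fun a => ?_⟩, hv, fun a => trivial⟩
    · rw [List.mem_toFinset] at ha
      rcases (hl a).mp (Or.inr (Or.inr ha)) with rfl | h
      · exact absurd ha hmv
      · exact h
    · constructor
      · intro ha
        have h1 := huv a ha
        refine ⟨?_, fun h => h1 a (Or.inr h) rfl⟩
        rcases (hl a).mp (Or.inl ha) with rfl | h
        · exact absurd rfl (h1 a (Or.inl rfl))
        · exact h
      · rintro ⟨ha, hav⟩
        rcases (hl a).mpr (Or.inr ha) with h | rfl | h
        · exact h
        · exact absurd ha hm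
        · exact absurd h hav
  · intros; rfl

/-- The generating polynomial attached to a descent word. -/
noncomputable def descentPoly : List Bool → ℕ[X]
  | [] => 1
  | b :: w => ∑ k ∈ Finset.range (w.length + 2), gaussBinom (w.length + 1) k *
      (X ^ (if b then 0 else k) * descentPoly (w.take (k - 1)) * descentPoly (w.drop k))
termination_by w => w.length
decreasing_by all_goals simp

/-- A form uniform in the empty word, matching the sum over subsets. The default of `headD` is
immaterial: for the empty word only `k = 0` occurs. -/
theorem descentPoly_eq (w : List Bool) :
    descentPoly w = ∑ k ∈ Finset.range (w.length + 1), gaussBinom w.length k *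
      (X ^ (if w.headD true then 0 else k) * descentPoly (w.take k).tail *
        descentPoly (w.drop k).tail) := by
  cases w with
  | nil => simp [descentPoly, gaussBinom]
  | cons b w =>
    rw [descentPoly]
    refine Finset.sum_congr rfl fun k _ => ?_
    cases k <;> simp

/-- The word `!D(o + m), …, !D(o + 1)`. -/
def complWord (D : ℕ → Bool) : ℕ → ℕ → List Bool
  | 0, _ => []
  | m + 1, o => (!D (o + m + 1)) :: complWord D m o

theorem length_complWord (D : ℕ → Bool) (m o : ℕ) : (complWord D m o).length = m := by
  induction m with
  | zero => rfl
  | succ m ih => simp [complWord, ih]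

theorem tail_complWord (D : ℕ → Bool) (m o : ℕ) :
    (complWord D m o).tail = complWord D (m - 1) o := by
  cases m <;> rfl

theorem drop_complWord (D : ℕ → Bool) (m o k : ℕ) :
    (complWord D m o).drop k = complWord D (m - k) o := by
  induction k with
  | zero => rfl
  | succ k ih => rw [← List.tail_drop, ih, tail_complWord, Nat.sub_sub]

theorem take_complWord (D : ℕ → Bool) (j k o : ℕ) :
    (complWord D (j + k) o).take k = complWord D k (o + j) := by
  induction k with
  | zero => rfl
  | succ k ih =>
    rw [← Nat.add_assoc, complWord, List.take_succ_cons, ih, complWord]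
    congr 4
    omega

theorem headD_complWord (D : ℕ → Bool) {m : ℕ} (hm : m ≠ 0) (o : ℕ) :
    (complWord D m o).headD true = !D (o + m) := by
  obtain ⟨m, rfl⟩ := Nat.exists_eq_succ_of_ne_zero hm
  rfl

/-- Only the cardinality of `A` matters: the exponent sees relative order and shape, while `D` is
tested on the minimal word over `o, o + 1, …`. The letter `o` is never the larger one of an
inversion, hence a descent word of length `A.card - 1`. -/
theorem sum_arrangements_wordExponent (D : ℕ → Bool) (A : Finset ℕ) (o : ℕ) :
    ∑ l ∈ arrangements A, (X : ℕ[X]) ^ wordExponent D o l =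
      descentPoly (complWord D (A.card - 1) o) := by
  induction hn : A.card using Nat.strong_induction_on generalizing A o with
  | _ n ih =>
  rcases A.eq_empty_or_nonempty with rfl | hne
  · obtain rfl : n = 0 := by simpa using hn.symm
    have : arrangements ∅ = {[]} := by ext l; simp [mem_arrangements', eq_comm]
    simp [this, complWord, descentPoly, wordExponent, wordInv, wordShape_nil, treeInv]
  obtain ⟨m, A, hA, rfl⟩ : ∃ m B, (∀ b ∈ B, b < m) ∧ A = insert m B := by
    refine ⟨A.max' hne, A.erase (A.max' hne), fun b hb => A.lt_max'_of_mem_erase_max' hne hb, ?_⟩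
    rw [Finset.insert_erase (A.max'_mem hne)]
  have hm : m ∉ A := fun h => lt_irrefl m (hA m h)
  rw [Finset.card_insert_of_notMem hm] at hn
  subst hn
  rw [sum_arrangements _ hm, Nat.add_sub_cancel, descentPoly_eq, length_complWord,
    ← sum_powerset_crossings fun k => X ^ (if (complWord D A.card o).headD true then 0 else k) *
      descentPoly ((complWord D A.card o).take k).tail *
        descentPoly ((complWord D A.card o).drop k).tail]
  refine Finset.sum_congr rfl fun C hC => ?_
  rw [Finset.mem_powerset] at hC
  have hcard := Finset.card_sdiff_add_card_eq_card hC
  have h1 : ∀ u ∈ arrangements (A \ C), ∀ v ∈ arrangements C,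
      (X : ℕ[X]) ^ wordExponent D o (u ++ m :: v) =
      X ^ (∑ b ∈ A \ C, (C.filter (· < b)).card) *
        X ^ (if (complWord D A.card o).headD true then 0 else C.card) *
        (X ^ wordExponent D o u * X ^ wordExponent D (o + (A \ C).card) v) := by
    intro u hu v hv
    have hu' := mem_arrangements.mp hu
    have hv' := mem_arrangements.mp hv
    rw [wordExponent_split
      (fun a ha => hA a (Finset.mem_sdiff.mp ((hu'.2 a).mp ha)).1)
      (fun a ha => hA a (hC ((hv'.2 a).mp ha))) hu'.1 hv'.1, crossInv_of_mem_arrangements hu hv,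
      length_of_mem_arrangements hu, length_of_mem_arrangements hv, Nat.add_assoc o, hcard]
    -- With `A` empty the descent word has no head, but then `C` is empty and both exponents are
    -- `0`.
    have : (if D (o + A.card) = true then C.card else 0) =
        if (complWord D A.card o).headD true = true then 0 else C.card := by
      rcases Nat.eq_zero_or_pos A.card with h | h
      · have : C.card = 0 := by omega
        simp [this]
      · rw [headD_complWord D h.ne']
        cases D (o + A.card) <;> simp
    rw [this]
    ring
  rw [Finset.sum_congr rfl fun u hu => Finset.sum_congr rfl (h1 u hu)]
  simp only [← Finset.mul_sum, ← Finset.sum_mul]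
  rw [ih _ (by omega) _ o rfl, ih _ (by omega) _ _ rfl, drop_complWord, tail_complWord]
  -- The first `C.card` letters of the descent word belong to the right factor `v`, whose letters in
  -- the minimal word are the larger ones, and the rest to `u`.
  have h2 : A.card - C.card = (A \ C).card := by omega
  rw [h2, ← hcard, take_complWord, tail_complWord]
  ring

theorem sum_ribbonStat {n : ℕ} (I : Composition n) :
    ∑ σ : Equiv.Perm (Fin n), ribbonStat I σ =
      descentPoly (complWord (fun d => decide (d ∈ descentSet (conjugate I))) (n - 1) 0) := by
  have h := sum_arrangements_wordExponent
    (fun d => decide (d ∈ descentSet (conjugate I))) (Finset.range n) 0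
  rw [Finset.card_range] at h
  rw [← h]
  refine Finset.sum_bij (fun σ _ => invWord σ) ?_ (fun _ _ _ _ h => invWord_injective h) ?_
    (fun σ _ => ribbonStat_eq I σ)
  · intro σ _
    rw [mem_arrangements]
    exact ⟨nodup_invWord σ, fun a => by rw [mem_invWord, Finset.mem_range]⟩
  · intro l hl
    have hlen := length_of_mem_arrangements hl
    rw [mem_arrangements] at hl
    rw [Finset.card_range] at hlen
    obtain ⟨σ, hσ⟩ := exists_invWord hl.1 hlen fun a ha => by
      rw [← Finset.mem_range]; exact (hl.2 a).mp ha
    exact ⟨σ, Finset.mem_univ σ, hσ⟩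

theorem eval_one_sum_ribbonStat {n : ℕ} (I : Composition n) :
    eval 1 (∑ σ : Equiv.Perm (Fin n), ribbonStat I σ) = n.factorial := by
  simp [eval_finsetSum, ribbonStat, Fintype.card_perm]

/-! ### Ribbons indexed by descent words -/

/-- The words of length `m` in two letters. -/
def boolWords : ℕ → Finset (List Bool)
  | 0 => {[]}
  | m + 1 => (boolWords m).image (List.cons true) ∪ (boolWords m).image (List.cons false)

theorem mem_boolWords {m : ℕ} {w : List Bool} : w ∈ boolWords m ↔ w.length = m := by
  induction m generalizing w with
  | zero => simp [boolWords]
  | succ m ih =>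
    rcases w with _ | ⟨_ | _, w⟩ <;> simp [boolWords, ih]

theorem sum_boolWords_succ {M : Type*} [AddCommMonoid M] (m : ℕ) (f : List Bool → M) :
    ∑ w ∈ boolWords (m + 1), f w = ∑ w ∈ boolWords m, (f (true :: w) + f (false :: w)) := by
  rw [boolWords, Finset.sum_union, Finset.sum_image (by simp), Finset.sum_image (by simp),
    Finset.sum_add_distrib]
  rw [Finset.disjoint_left]
  simp

theorem sum_boolWords_add {M : Type*} [AddCommMonoid M] (a b : ℕ) (f : List Bool → M) :
    ∑ w ∈ boolWords (a + b), f w = ∑ u ∈ boolWords a, ∑ v ∈ boolWords b, f (u ++ v) := by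
  induction a generalizing f with
  | zero => simp [boolWords]
  | succ a ih =>
    rw [Nat.succ_add, sum_boolWords_succ, ih, sum_boolWords_succ]
    simp only [List.cons_append, Finset.sum_add_distrib]

section

variable (K : Type*) [Field K]

/-- The ribbon function of a descent word, read with a first part that starts at `k`; for `k = 1`
this is the ribbon function of the composition with that descent word. -/
noncomputable def wordRibbon : List Bool → ℕ → NCSym K
  | [], k => completeS K k
  | false :: w, k => wordRibbon w (k + 1)
  | true :: w, k => completeS K k * wordRibbon w 1 - wordRibbon w (k + 1)

/-- The product of complete functions attached to a descent word. -/
noncomputable def wordComplete : List Bool → ℕ → NCSym K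
  | [], k => completeS K k
  | false :: w, k => wordComplete w (k + 1)
  | true :: w, k => completeS K k * wordComplete w 1

/-- The product rule for ribbons: the two ribbons are glued with a descent or without one. -/
theorem wordRibbon_mul (u w : List Bool) (k : ℕ) :
    wordRibbon K u k * wordRibbon K w 1 =
      wordRibbon K (u ++ true :: w) k + wordRibbon K (u ++ false :: w) k := by
  induction u generalizing k with
  | nil => simp [wordRibbon]
  | cons b u ih =>
    cases b
    · simp only [List.cons_append, wordRibbon, ih]
    · simp only [List.cons_append, wordRibbon, sub_mul, mul_assoc, ih]
      rw [mul_add]; abel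

theorem count_le_of_forall₂ {v w : List Bool} (h : List.Forall₂ (fun a b => a = true → b = true) v w) :
    v.count true ≤ w.count true := by
  induction h with
  | nil => simp
  | @cons a b v w hab _ ih =>
    cases a <;> cases b <;> simp_all
    omega

-- Each letter `true` of `w` is either kept or erased with a sign, so expanding the recursion runs
-- over all coarsenings.
open Classical in
theorem wordRibbon_eq_sum (w : List Bool) (k : ℕ) :
    wordRibbon K w k = ∑ v ∈ boolWords w.length,
      if List.Forall₂ (fun a b => a = true → b = true) v w then
        (-1 : K) ^ (w.count true - v.count true) • wordComplete K v k else 0 := by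
  induction w generalizing k with
  | nil => simp [boolWords, wordRibbon, wordComplete]
  | cons b w ih =>
    rw [List.length_cons, sum_boolWords_succ]
    cases b
    · rw [wordRibbon, ih]
      refine Finset.sum_congr rfl fun v _ => ?_
      simp [wordComplete]
    · rw [wordRibbon, ih, ih, Finset.mul_sum, ← Finset.sum_sub_distrib]
      refine Finset.sum_congr rfl fun v _ => ?_
      by_cases h : List.Forall₂ (fun a b => a = true → b = true) v w
      · have hc := count_le_of_forall₂ h
        have h1 : w.count true + 1 - v.count true = w.count true - v.count true + 1 := by omega
        simp [h, wordComplete, h1, pow_succ, sub_eq_add_neg]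
      · simp [h]

/-- The relation S_k R_v = R_{true::v} + R_{false::v} lets complete products be expanded in ribbons
one letter at a time. -/
theorem wordComplete_mem_span (w : List Bool) (k : ℕ) :
    wordComplete K w k ∈
      Submodule.span K ((fun v => wordRibbon K v k) '' {v | v.length = w.length}) := by
  induction w generalizing k with
  | nil => exact Submodule.subset_span ⟨[], rfl, rfl⟩
  | cons b w ih =>
    cases b
    · rw [wordComplete]
      refine Submodule.span_mono ?_ (ih (k + 1))
      rintro _ ⟨v, hv, rfl⟩
      exact ⟨false :: v, by simpa using hv, rfl⟩
    · rw [wordComplete]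
      have h := Submodule.mem_map_of_mem (f := LinearMap.mulLeft K (completeS K k)) (ih 1)
      rw [Submodule.map_span, LinearMap.mulLeft_apply] at h
      refine (Submodule.span_le.mpr ?_) h
      rintro _ ⟨_, ⟨v, hv, rfl⟩, rfl⟩
      have h2 : completeS K k * wordRibbon K v 1 =
          wordRibbon K (true :: v) k + wordRibbon K (false :: v) k := by simp [wordRibbon]
      rw [LinearMap.mulLeft_apply, h2]
      exact Submodule.add_mem _ (Submodule.subset_span ⟨true :: v, by simpa using hv, rfl⟩)
        (Submodule.subset_span ⟨false :: v, by simpa using hv, rfl⟩)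

end

/-! ### Descent words of compositions -/

/-- The blocks of the composition with a given descent word, the first block starting at `k`. -/
def wordBlocks : List Bool → ℕ → List ℕ
  | [], k => [k]
  | false :: w, k => wordBlocks w (k + 1)
  | true :: w, k => k :: wordBlocks w 1

theorem sum_wordBlocks (w : List Bool) (k : ℕ) : (wordBlocks w k).sum = k + w.length := by
  induction w generalizing k with
  | nil => simp [wordBlocks]
  | cons b w ih => cases b <;> simp [wordBlocks, ih] <;> omega

theorem wordBlocks_pos (w : List Bool) {k : ℕ} (hk : 0 < k) : ∀ i ∈ wordBlocks w k, 0 < i := by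
  induction w generalizing k with
  | nil => simpa [wordBlocks]
  | cons b w ih =>
    cases b
    · exact ih (Nat.succ_pos k)
    · simpa [wordBlocks, hk] using ih Nat.one_pos

theorem length_wordBlocks (w : List Bool) (k : ℕ) :
    (wordBlocks w k).length = w.count true + 1 := by
  induction w generalizing k with
  | nil => simp [wordBlocks]
  | cons b w ih => cases b <;> simp [wordBlocks, ih]

theorem prod_completeS_wordBlocks (K : Type*) [Field K] (w : List Bool) (k : ℕ) :
    ((wordBlocks w k).map (completeS K)).prod = wordComplete K w k := by
  induction w generalizing k with
  | nil => simp [wordBlocks, wordComplete]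
  | cons b w ih => cases b <;> simp [wordBlocks, wordComplete, ih]

theorem exists_sum_take_wordBlocks (w : List Bool) (k d : ℕ) :
    (∃ i, (1 ≤ i ∧ i < (wordBlocks w k).length) ∧ ((wordBlocks w k).take i).sum = d) ↔
      ∃ i, w[i]? = some true ∧ d = k + i := by
  induction w generalizing k d with
  | nil => simp [wordBlocks]
  | cons b w ih =>
    cases b
    · rw [wordBlocks, ih]
      constructor
      · rintro ⟨i, hi, rfl⟩
        exact ⟨i + 1, by simpa using hi, by omega⟩
      · rintro ⟨_ | i, hi, rfl⟩
        · simp at hi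
        · exact ⟨i, by simpa using hi, by omega⟩
    · rw [wordBlocks]
      constructor
      · rintro ⟨_ | _ | i, ⟨h1, h2⟩, h3⟩
        · omega
        · exact ⟨0, by simp, by simpa using h3.symm⟩
        · obtain ⟨j, hj, hj'⟩ := (ih 1 _).mp ⟨i + 1, ⟨by omega, by simpa using h2⟩, rfl⟩
          rw [List.take_succ_cons, List.sum_cons, hj'] at h3
          exact ⟨j + 1, by simpa using hj, by omega⟩
      · rintro ⟨_ | i, hi, rfl⟩
        · exact ⟨1, ⟨le_rfl, by simp [length_wordBlocks]⟩, by simp⟩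
        · obtain ⟨j, ⟨hj, hj'⟩, hs⟩ := (ih 1 (1 + i)).mpr ⟨i, by simpa using hi, rfl⟩
          exact ⟨j + 1, ⟨by omega, by simpa using hj'⟩, by
            rw [List.take_succ_cons, List.sum_cons, hs]; omega⟩

/-- The composition with a given descent word. -/
def wordComposition {n : ℕ} (w : List.Vector Bool n) : Composition (n + 1) where
  blocks := wordBlocks w.1 1
  blocks_pos := fun {i} hi => wordBlocks_pos w.1 Nat.one_pos i hi
  blocks_sum := by rw [sum_wordBlocks, w.2, add_comm]

theorem mem_descentSet_wordComposition {n : ℕ} (w : List.Vector Bool n) (d : ℕ) :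
    d ∈ descentSet (wordComposition w) ↔ ∃ i, w.1[i]? = some true ∧ d = 1 + i := by
  rw [← exists_sum_take_wordBlocks, descentSet, Finset.mem_image]
  simp only [Finset.mem_Ico]
  rfl

/-- The indicator word of the descent set of a composition. -/
def descentWord {n : ℕ} (I : Composition (n + 1)) : List Bool :=
  List.ofFn fun i : Fin n => decide ((i : ℕ) + 1 ∈ descentSet I)

theorem length_descentWord {n : ℕ} (I : Composition (n + 1)) : (descentWord I).length = n := by
  simp [descentWord]

theorem descentWord_wordComposition {n : ℕ} (w : List.Vector Bool n) :
    descentWord (wordComposition w) = w.1 := by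
  refine List.ext_getElem (by rw [length_descentWord, w.2]) fun i h1 h2 => ?_
  simp only [descentWord, List.getElem_ofFn]
  rw [Bool.eq_iff_iff, decide_eq_true_iff, mem_descentSet_wordComposition]
  constructor
  · rintro ⟨j, hj, hij⟩
    obtain rfl : i = j := by omega
    rwa [List.getElem?_eq_getElem h2, Option.some_inj] at hj
  · intro h
    exact ⟨i, by rw [List.getElem?_eq_getElem h2, h], by omega⟩

theorem wordComposition_bijective (n : ℕ) :
    Function.Bijective (wordComposition (n := n)) := by
  rw [Fintype.bijective_iff_injective_and_card]
  refine ⟨fun v w h => Subtype.ext ?_, ?_⟩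
  · rw [← descentWord_wordComposition v, h, descentWord_wordComposition w]
  · rw [composition_card, card_vector]; simp

theorem sum_composition_succ {M : Type*} [AddCommMonoid M] (n : ℕ) (f : List Bool → M) :
    ∑ I : Composition (n + 1), f (descentWord I) = ∑ w ∈ boolWords n, f w := by
  refine Finset.sum_bij (fun I _ => descentWord I) ?_ ?_ ?_ (fun _ _ => rfl)
  · intro I _
    rw [mem_boolWords, length_descentWord]
  · intro I _ J _ h
    obtain ⟨v, rfl⟩ := (wordComposition_bijective n).2 I
    obtain ⟨w, rfl⟩ := (wordComposition_bijective n).2 J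
    rw [descentWord_wordComposition, descentWord_wordComposition] at h
    rw [Subtype.ext h]
  · intro w hw
    exact ⟨wordComposition ⟨w, mem_boolWords.mp hw⟩, Finset.mem_univ _,
      descentWord_wordComposition _⟩

theorem length_eq_count {n : ℕ} (I : Composition (n + 1)) :
    I.length = (descentWord I).count true + 1 := by
  obtain ⟨w, rfl⟩ := (wordComposition_bijective n).2 I
  rw [descentWord_wordComposition]
  exact length_wordBlocks _ _

theorem completeProd_eq (K : Type*) [Field K] {n : ℕ} (I : Composition (n + 1)) :
    completeProd K I = wordComplete K (descentWord I) 1 := by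
  obtain ⟨w, rfl⟩ := (wordComposition_bijective n).2 I
  rw [descentWord_wordComposition]
  exact prod_completeS_wordBlocks K _ _

theorem descentSet_subset_iff {n : ℕ} (I J : Composition (n + 1)) :
    descentSet J ⊆ descentSet I ↔
      List.Forall₂ (fun a b => a = true → b = true) (descentWord J) (descentWord I) := by
  rw [List.forall₂_iff_get]
  constructor
  · intro h
    refine ⟨by simp [length_descentWord], fun i h1 h2 => ?_⟩
    simp only [descentWord, List.get_ofFn, decide_eq_true_iff]
    exact fun hi => h hi
  · rintro ⟨-, h⟩ d hd
    obtain ⟨w, rfl⟩ := (wordComposition_bijective n).2 J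
    obtain ⟨i, hi, rfl⟩ := (mem_descentSet_wordComposition w d).mp hd
    have hin : i < n := by
      have := (List.getElem?_eq_some_iff.mp hi).1
      rwa [w.2] at this
    have := h i (by rwa [length_descentWord]) (by rwa [length_descentWord])
    simp only [descentWord, List.get_ofFn, decide_eq_true_iff, Fin.val_cast] at this
    have hi1 : 1 + i = i + 1 := add_comm 1 i
    simp only [hi1] at hd ⊢
    exact this hd

theorem ribbon_eq (K : Type*) [Field K] {n : ℕ} (I : Composition (n + 1)) :
    ribbon K I = wordRibbon K (descentWord I) 1 := by
  classical
  rw [wordRibbon_eq_sum, length_descentWord, ← sum_composition_succ, ribbon, Finset.sum_filter]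
  refine Finset.sum_congr rfl fun J _ => ?_
  rw [completeProd_eq, length_eq_count, length_eq_count, Nat.add_sub_add_right]
  simp only [descentSet_subset_iff]

theorem mem_descentSet_iff_mem_boundaries {n : ℕ} (I : Composition n) {d : ℕ} (h0 : 0 < d)
    (hd : d < n) : d ∈ descentSet I ↔ (⟨d, by omega⟩ : Fin (n + 1)) ∈ I.boundaries := by
  simp only [descentSet, Finset.mem_image, Finset.mem_Ico, Composition.boundaries, Finset.mem_map,
    Finset.mem_univ, true_and]
  constructor
  · rintro ⟨i, hi, rfl⟩
    exact ⟨⟨i, by omega⟩, rfl⟩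
  · rintro ⟨⟨i, hi⟩, h⟩
    have h1 : I.sizeUpTo i = d := congrArg Fin.val h
    refine ⟨i, ⟨?_, ?_⟩, h1⟩
    · rcases Nat.eq_zero_or_pos i with rfl | h2
      · rw [I.sizeUpTo_zero] at h1; omega
      · exact h2
    · by_contra h2
      rw [I.sizeUpTo_ofLength_le i (by omega)] at h1
      omega

theorem mem_descentSet_conjugate {n : ℕ} (I : Composition n) {d : ℕ} (h0 : 0 < d) (hd : d < n) :
    d ∈ descentSet (conjugate I) ↔ n - d ∉ descentSet I := by
  rw [mem_descentSet_iff_mem_boundaries _ h0 hd]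
  have h : ∀ c : CompositionAsSet n, ((compositionEquiv n).symm c).boundaries = c.boundaries :=
    CompositionAsSet.toComposition_boundaries
  rw [conjugate, h]
  simp only [compositionAsSetEquiv, Equiv.coe_fn_symm_mk, Set.mem_toFinset, Set.mem_ofPred_eq,
    Finset.mem_filter, Finset.mem_univ, true_and, Fin.ext_iff, Fin.val_zero, Fin.val_last,
    exists_prop]
  constructor
  · rintro (h | h | ⟨j, hj, h⟩)
    · omega
    · omega
    · rwa [h]
  · intro h
    refine Or.inr (Or.inr ⟨⟨d - 1, by omega⟩, ?_, ?_⟩)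
    · simpa [Nat.sub_add_cancel h0] using h
    · simp only; omega

theorem complWord_eq_ofFn (D : ℕ → Bool) (m o : ℕ) :
    complWord D m o = List.ofFn fun i : Fin m => !D (o + m - i) := by
  induction m with
  | zero => rfl
  | succ m ih =>
    rw [complWord, ih, List.ofFn_succ]
    congr 2
    funext i
    rw [Fin.val_succ, show o + (m + 1) - (i + 1) = o + m - i by omega]

/-- The reversal and complementation in `complWord` undo those in the conjugate. -/
theorem complWord_conjugate {n : ℕ} (I : Composition (n + 1)) :
    complWord (fun d => decide (d ∈ descentSet (conjugate I))) n 0 = descentWord I := by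
  rw [complWord_eq_ofFn, descentWord]
  congr 1
  funext i
  have hi := i.isLt
  rw [← decide_not]
  congr 1
  rw [mem_descentSet_conjugate I (by omega) (by omega), not_not,
    show n + 1 - (0 + n - (i : ℕ)) = i + 1 by omega]

/-! ### The ribbon basis -/

theorem basisFreeMonoid_apply (K : Type*) [Field K] (w : FreeMonoid ℕ+) :
    FreeAlgebra.basisFreeMonoid K ℕ+ w = FreeMonoid.lift (FreeAlgebra.ι K) w := by
  simp [FreeAlgebra.basisFreeMonoid, FreeAlgebra.equivMonoidAlgebraFreeMonoid]

theorem completeProd_eq_basis (K : Type*) [Field K] {n : ℕ} (I : Composition n) :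
    completeProd K I = FreeAlgebra.basisFreeMonoid K ℕ+
      (FreeMonoid.ofList (I.blocks.map Nat.toPNat')) := by
  rw [basisFreeMonoid_apply, FreeMonoid.lift_apply, FreeMonoid.toList_ofList, List.map_map,
    completeProd]
  congr 1
  refine List.map_congr_left fun b hb => ?_
  obtain ⟨b, rfl⟩ := Nat.exists_eq_succ_of_ne_zero (I.blocks_pos hb).ne'
  rfl

theorem linearIndependent_completeProd (K : Type*) [Field K] (n : ℕ) :
    LinearIndependent K fun I : Composition n => completeProd K I := by
  simp only [completeProd_eq_basis]
  refine (FreeAlgebra.basisFreeMonoid K ℕ+).linearIndependent.comp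
    (fun I : Composition n => FreeMonoid.ofList (I.blocks.map Nat.toPNat')) fun I J h => ?_
  have h1 : I.blocks.map Nat.toPNat' = J.blocks.map Nat.toPNat' := h
  have h2 : ∀ I : Composition n, (I.blocks.map Nat.toPNat').map PNat.val = I.blocks := by
    intro I
    rw [List.map_map]
    conv_rhs => rw [← List.map_id I.blocks]
    refine List.map_congr_left fun b hb => ?_
    obtain ⟨b, rfl⟩ := Nat.exists_eq_succ_of_ne_zero (I.blocks_pos hb).ne'
    rfl
  exact Composition.ext (by rw [← h2 I, ← h2 J, h1])

theorem ribbon_mem_homogeneousPart (K : Type*) [Field K] {n : ℕ} (I : Composition n) :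
    ribbon K I ∈ homogeneousPart K n :=
  Submodule.sum_mem _ fun J _ => Submodule.smul_mem _ _ (Submodule.subset_span ⟨J, rfl⟩)

theorem ribbon_zero (K : Type*) [Field K] (I : Composition 0) : ribbon K I = 1 := by
  have h : ∀ J : Composition 0, completeProd K J = 1 := fun J => by
    rw [completeProd, J.blocks_eq_nil.mpr rfl]; rfl
  have : Subsingleton (Composition 0) := ⟨fun I J => Composition.ext (by
    rw [I.blocks_eq_nil.mpr rfl, J.blocks_eq_nil.mpr rfl])⟩
  rw [ribbon, Finset.filter_true_of_mem, Fintype.sum_subsingleton _ I, h]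
  · simp
  · intro J _
    rw [Subsingleton.elim J I]

theorem span_ribbon (K : Type*) [Field K] (n : ℕ) :
    Submodule.span K (Set.range fun I : Composition n => ribbon K I) = homogeneousPart K n := by
  refine le_antisymm (Submodule.span_le.mpr ?_) (Submodule.span_le.mpr ?_)
  · rintro _ ⟨I, rfl⟩
    exact ribbon_mem_homogeneousPart K I
  · rintro _ ⟨I, rfl⟩
    cases n with
    | zero =>
      refine Submodule.subset_span ⟨I, ?_⟩
      simp only [ribbon_zero]
      rw [completeProd, I.blocks_eq_nil.mpr rfl]; rfl
    | succ n =>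
      simp only [completeProd_eq]
      refine Submodule.span_mono ?_ (wordComplete_mem_span K (descentWord I) 1)
      rintro _ ⟨v, hv, rfl⟩
      rw [Set.mem_ofPred_eq, length_descentWord] at hv
      obtain ⟨w, rfl⟩ : ∃ w : List.Vector Bool n, w.1 = v := ⟨⟨v, hv⟩, rfl⟩
      refine ⟨wordComposition w, ?_⟩
      change ribbon K _ = _
      rw [ribbon_eq, descentWord_wordComposition]

/-- The ribbons span a space whose dimension, computed from the complete products, equals their
number. -/
theorem linearIndependent_ribbon (K : Type*) [Field K] (n : ℕ) :
    LinearIndependent K fun I : Composition n => ribbon K I := by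
  rw [linearIndependent_iff_card_eq_finrank_span, Set.finrank, span_ribbon]
  exact (linearIndependent_iff_card_eq_finrank_span.mp (linearIndependent_completeProd K n))

open Finset.HasAntidiagonal (antidiagonal mem_antidiagonal)

/-! ### Enlarging the first part -/

/-- The linear map `S_a X ↦ S_{a+1} X`. -/
noncomputable def firstShift (K : Type*) [Field K] : NCSym K →ₗ[K] NCSym K :=
  (FreeAlgebra.basisFreeMonoid K ℕ+).constr K fun w =>
    match FreeMonoid.toList w with
    | [] => 0
    | a :: w => FreeAlgebra.ι K (a + 1) * FreeMonoid.lift (FreeAlgebra.ι K) (FreeMonoid.ofList w)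

section

variable {K : Type*} [Field K]

theorem firstShift_ι_mul (a : ℕ+) (x : NCSym K) :
    firstShift K (FreeAlgebra.ι K a * x) = FreeAlgebra.ι K (a + 1) * x := by
  have h : firstShift K ∘ₗ LinearMap.mulLeft K (FreeAlgebra.ι K a) =
      LinearMap.mulLeft K (FreeAlgebra.ι K (a + 1)) := by
    refine (FreeAlgebra.basisFreeMonoid K ℕ+).ext fun w => ?_
    have h1 : FreeAlgebra.ι K a * FreeAlgebra.basisFreeMonoid K ℕ+ w =
        FreeAlgebra.basisFreeMonoid K ℕ+ (FreeMonoid.of a * w) := by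
      simp [basisFreeMonoid_apply]
    rw [LinearMap.comp_apply, LinearMap.mulLeft_apply, LinearMap.mulLeft_apply, h1, firstShift,
      Module.Basis.constr_basis, basisFreeMonoid_apply]
    rfl
  exact LinearMap.congr_fun h x

theorem firstShift_completeS_mul (k : ℕ) (x : NCSym K) :
    firstShift K (completeS K (k + 1) * x) = completeS K (k + 2) * x :=
  firstShift_ι_mul _ _

/-- Every term of the expanded ribbon begins with some S_a, a ≥ 1, so the shift never meets the
product's right factor. The index `k + 1` is essential: with first part 0 the leading factor could
be S_0 = 1. -/
theorem firstShift_wordRibbon_mul (w : List Bool) (k : ℕ) (y : NCSym K) :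
    firstShift K (wordRibbon K w (k + 1) * y) = wordRibbon K w (k + 2) * y := by
  induction w generalizing k with
  | nil => exact firstShift_completeS_mul k y
  | cons b w ih =>
    cases b
    · exact ih (k + 1)
    · rw [wordRibbon, wordRibbon, sub_mul, sub_mul, map_sub, ih, mul_assoc, mul_assoc,
        firstShift_completeS_mul]

theorem firstShift_wordRibbon (w : List Bool) (k : ℕ) :
    firstShift K (wordRibbon K w (k + 1)) = wordRibbon K w (k + 2) := by
  simpa using firstShift_wordRibbon_mul w k 1

/-! ### The Poincaré equation in each degree -/

theorem coeff_poincare_term (g : ℕ → NCSym K) (a : NCSym K) (n j m : ℕ) :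
    PowerSeries.coeff m (PowerSeries.X ^ n * PowerSeries.C a * gradedSeries g ^ j) =
      if n ≤ m then a * PowerSeries.coeff (m - n) (gradedSeries g ^ j) else 0 := by
  rw [mul_assoc, PowerSeries.coeff_X_pow_mul']
  simp [PowerSeries.coeff_C_mul]

/-- The part of positive index of the right-hand side of the Poincaré equation. -/
noncomputable def poincareTail (g : ℕ → NCSym K) (m : ℕ) : NCSym K :=
  ∑ n ∈ Finset.range m, completeS K (n + 1) *
    PowerSeries.coeff (m - (n + 1)) (gradedSeries g ^ (n + 2))

theorem coeff_poincareRHS (g : ℕ → NCSym K) (m : ℕ) :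
    PowerSeries.coeff m (poincareRHS g) = g m + poincareTail g m := by
  rw [poincareRHS, PowerSeries.coeff_mk, Finset.sum_range_succ', add_comm, poincareTail]
  congr 1
  · rw [coeff_poincare_term]
    simp [completeS, gradedSeries]
  · refine Finset.sum_congr rfl fun n hn => ?_
    rw [coeff_poincare_term, if_pos (Nat.succ_le_of_lt (Finset.mem_range.mp hn))]

theorem poincare_equation_iff (q : K) (g : ℕ → NCSym K) :
    gradedSeries (fun n => q ^ n • g n) = poincareRHS g ↔
      ∀ m, (q ^ m - 1) • g m = poincareTail g m := by
  rw [PowerSeries.ext_iff]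
  refine forall_congr' fun m => ?_
  rw [coeff_poincareRHS, gradedSeries, PowerSeries.coeff_mk, sub_smul, one_smul,
    sub_eq_iff_eq_add']

theorem coeff_gradedSeries_pow_congr {g h : ℕ → NCSym K} {m : ℕ} (hgh : ∀ i ≤ m, g i = h i)
    (j : ℕ) : ∀ i ≤ m, PowerSeries.coeff i (gradedSeries g ^ j) =
      PowerSeries.coeff i (gradedSeries h ^ j) := by
  induction j with
  | zero => simp
  | succ j ih =>
    intro i hi
    rw [pow_succ, pow_succ, PowerSeries.coeff_mul, PowerSeries.coeff_mul]
    refine Finset.sum_congr rfl fun p hp => ?_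
    rw [mem_antidiagonal] at hp
    rw [ih p.1 (by omega)]
    simp only [gradedSeries, PowerSeries.coeff_mk]
    rw [hgh p.2 (by omega)]

theorem poincareTail_congr {g h : ℕ → NCSym K} {m : ℕ} (hgh : ∀ i < m, g i = h i) :
    poincareTail g m = poincareTail h m := by
  refine Finset.sum_congr rfl fun n hn => ?_
  rw [Finset.mem_range] at hn
  rw [coeff_gradedSeries_pow_congr (m := m - (n + 1)) (fun i hi => hgh i (by omega)) _ _ le_rfl]

/-- In degree `m > 0` the tail involves only components of degree below `m`, and q^m - 1 is
invertible. -/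
theorem IsPoincareSolution.unique {q : K} (hq : ∀ n : ℕ, 1 ≤ n → q ^ n ≠ 1)
    {g h : ℕ → NCSym K} (hg : IsPoincareSolution q g) (hh : IsPoincareSolution q h) : g = h := by
  funext m
  induction m using Nat.strong_induction_on with
  | _ m ih =>
  rcases Nat.eq_zero_or_pos m with rfl | hm
  · rw [hg.zero, hh.zero]
  · have h1 := (poincare_equation_iff q g).mp hg.equation m
    rw [poincareTail_congr ih, ← (poincare_equation_iff q h).mp hh.equation m] at h1
    exact smul_right_injective _ (sub_ne_zero.mpr (hq m hm)) h1

/-- The padding with zero terms makes the range independent of `m`, so that the sums in a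
convolution can be exchanged. -/
theorem poincareTail_eq_sum_range (g : ℕ → NCSym K) {m N : ℕ} (h : m ≤ N) :
    poincareTail g m = ∑ n ∈ Finset.range N, PowerSeries.coeff m
      (PowerSeries.X ^ (n + 1) * PowerSeries.C (completeS K (n + 1)) *
        gradedSeries g ^ (n + 2)) := by
  rw [← Finset.sum_subset (Finset.range_subset_range.mpr h)]
  · refine Finset.sum_congr rfl fun n hn => ?_
    rw [coeff_poincare_term, if_pos (Nat.succ_le_of_lt (Finset.mem_range.mp hn))]
  · intro n _ hn
    rw [coeff_poincare_term, if_neg (by simpa [Nat.succ_le_iff] using hn)]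

/-- This is T = S_1 g² + Ω(T g) in degree `m + 1`: the shift sends S_n g^{n+1} · g to S_{n+1}
g^{n+2}. -/
theorem poincareTail_succ (g : ℕ → NCSym K) (m : ℕ) :
    poincareTail g (m + 1) = ∑ p ∈ antidiagonal m,
      (completeS K 1 * (g p.1 * g p.2) + firstShift K (poincareTail g p.1 * g p.2)) := by
  have h0 : PowerSeries.coeff m (gradedSeries g ^ 2) =
      ∑ p ∈ antidiagonal m, g p.1 * g p.2 := by
    simp [pow_two, PowerSeries.coeff_mul, gradedSeries]
  have h1 : ∑ p ∈ antidiagonal m, poincareTail g p.1 * g p.2 =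
      ∑ n ∈ Finset.range m, completeS K (n + 1) *
        PowerSeries.coeff (m - (n + 1)) (gradedSeries g ^ (n + 3)) := by
    have h2 : ∀ p ∈ antidiagonal m, poincareTail g p.1 * g p.2 =
        ∑ n ∈ Finset.range m, PowerSeries.coeff p.1
          (PowerSeries.X ^ (n + 1) * PowerSeries.C (completeS K (n + 1)) *
            gradedSeries g ^ (n + 2)) * PowerSeries.coeff p.2 (gradedSeries g) := by
      intro p hp
      rw [mem_antidiagonal] at hp
      rw [poincareTail_eq_sum_range g (show p.1 ≤ m by omega), Finset.sum_mul]
      simp [gradedSeries]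
    rw [Finset.sum_congr rfl h2, Finset.sum_comm]
    refine Finset.sum_congr rfl fun n hn => ?_
    rw [← PowerSeries.coeff_mul, mul_assoc, ← pow_succ, coeff_poincare_term,
      if_pos (Nat.succ_le_of_lt (Finset.mem_range.mp hn))]
  rw [Finset.sum_add_distrib, ← Finset.mul_sum, ← h0, ← map_sum, h1, map_sum, poincareTail,
    Finset.sum_range_succ', add_comm]
  congr 1
  refine Finset.sum_congr rfl fun n _ => ?_
  rw [firstShift_completeS_mul, Nat.add_sub_add_right]

/-- A quadratic recursion implies the Poincaré equation. -/
theorem poincare_equation_of_quadratic {q : K} {g : ℕ → NCSym K}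
    (hshift : ∀ k y, firstShift K ((q ^ k - 1) • g k * y) =
      firstShift K ((q ^ k - 1) • g k) * y)
    (hg : ∀ m, (q ^ (m + 1) - 1) • g (m + 1) = ∑ p ∈ antidiagonal m,
      (completeS K 1 * g p.1 + firstShift K ((q ^ p.1 - 1) • g p.1)) * g p.2) :
    gradedSeries (fun n => q ^ n • g n) = poincareRHS g := by
  rw [poincare_equation_iff]
  intro m
  induction m using Nat.strong_induction_on with
  | _ m ih =>
  cases m with
  | zero => simp [poincareTail]
  | succ m =>
    rw [hg, poincareTail_succ]
    refine Finset.sum_congr rfl fun p hp => ?_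
    rw [mem_antidiagonal] at hp
    rw [← ih p.1 (by omega), hshift, add_mul, mul_assoc]

/-! ### The solution -/

/-- The sum of the ribbons of size `n`, weighted by the polynomials `descentPoly` at `q`. -/
noncomputable def ribbonSum (q : K) : ℕ → NCSym K
  | 0 => 1
  | m + 1 => ∑ w ∈ boolWords m, aeval q (descentPoly w) • wordRibbon K w 1

/-- From S_1 R_w = R_{true::w} + R_{false::w} and Ω R_w = R_{false::w}, the coefficient of
R_{false::w} is 1 + (q^k - 1) = q^k: the negative term cancels, which makes the coefficients lie in
ℕ[q]. -/
theorem shifted_ribbonSum (q : K) (k : ℕ) :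
    completeS K 1 * ribbonSum q k + (q ^ k - 1) • firstShift K (ribbonSum q k) =
      ∑ x ∈ boolWords k, (q ^ (if x.headD true then 0 else k) * aeval q (descentPoly x.tail)) •
        wordRibbon K x 1 := by
  cases k with
  | zero => simp [ribbonSum, boolWords, descentPoly, wordRibbon]
  | succ k =>
    rw [sum_boolWords_succ, ribbonSum, map_sum, Finset.mul_sum, Finset.smul_sum,
      ← Finset.sum_add_distrib]
    refine Finset.sum_congr rfl fun w _ => ?_
    rw [map_smul, firstShift_wordRibbon]
    simp only [List.headD_cons, List.tail_cons, if_true, pow_zero, one_mul, wordRibbon,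
      Bool.false_eq_true, if_false, mul_smul_comm, smul_sub, sub_smul, one_smul, mul_smul]
    abel

theorem wordRibbon_mul_ribbonSum (q : K) (x : List Bool) (l : ℕ) :
    wordRibbon K x 1 * ribbonSum q l =
      ∑ y ∈ boolWords l, aeval q (descentPoly y.tail) • wordRibbon K (x ++ y) 1 := by
  cases l with
  | zero => simp [ribbonSum, boolWords, descentPoly]
  | succ l =>
    rw [sum_boolWords_succ, ribbonSum, Finset.mul_sum]
    refine Finset.sum_congr rfl fun w _ => ?_
    rw [mul_smul_comm, wordRibbon_mul, smul_add]
    rfl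

/-- A descent word of length `m` is cut after its first `k` letters; the heads of the two pieces
come from S_1 or Ω and from the gluing, and their tails index the ribbons of the two factors. -/
theorem ribbonSum_succ (q : K) (m : ℕ) :
    ribbonSum q (m + 1) = ∑ p ∈ antidiagonal m, aeval q (gaussBinom m p.1) •
      ((completeS K 1 * ribbonSum q p.1 + (q ^ p.1 - 1) • firstShift K (ribbonSum q p.1)) *
        ribbonSum q p.2) := by
  have h1 : ∀ p ∈ antidiagonal m, aeval q (gaussBinom m p.1) •
      ((completeS K 1 * ribbonSum q p.1 + (q ^ p.1 - 1) • firstShift K (ribbonSum q p.1)) *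
        ribbonSum q p.2) =
      ∑ w ∈ boolWords m, (aeval q (gaussBinom m p.1) *
        (q ^ (if w.headD true then 0 else p.1) * aeval q (descentPoly (w.take p.1).tail) *
          aeval q (descentPoly (w.drop p.1).tail))) • wordRibbon K w 1 := by
    rintro ⟨k, l⟩ hp
    obtain rfl := mem_antidiagonal.mp hp
    rw [shifted_ribbonSum, sum_boolWords_add, Finset.sum_mul, Finset.smul_sum]
    refine Finset.sum_congr rfl fun x hx => ?_
    rw [mem_boolWords] at hx
    rw [smul_mul_assoc, wordRibbon_mul_ribbonSum, Finset.smul_sum, Finset.smul_sum]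
    refine Finset.sum_congr rfl fun y _ => ?_
    have h2 : (if (x ++ y).headD true = true then 0 else k) =
        if x.headD true = true then 0 else k := by
      cases x with
      | nil => obtain rfl : k = 0 := hx.symm
               simp
      | cons b x => rfl
    have h3 : (x ++ y).take k = x := List.take_left' hx
    have h4 : (x ++ y).drop k = y := List.drop_left' hx
    simp only [smul_smul, h2, h3, h4]
  rw [Finset.sum_congr rfl h1, Finset.sum_comm, ribbonSum]
  refine Finset.sum_congr rfl fun w hw => ?_
  rw [mem_boolWords] at hw
  rw [← Finset.sum_smul, descentPoly_eq, hw, map_sum,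
    Finset.Nat.sum_antidiagonal_eq_sum_range_succ_mk]
  congr 1
  refine Finset.sum_congr rfl fun k _ => ?_
  simp only [map_mul, map_pow, aeval_X]

theorem sum_ribbonStat_smul_ribbon (q : K) (n : ℕ) :
    ∑ I : Composition n,
      aeval q (∑ σ : Equiv.Perm (Fin n), ribbonStat I σ) • ribbon K I = ribbonSum q n := by
  cases n with
  | zero =>
    have h1 : Fintype.card (Composition 0) = 1 := by rw [composition_card]; rfl
    have h2 : ∀ D, descentPoly (complWord D (0 - 1) 0) = 1 := fun D => by
      rw [Nat.zero_sub, complWord, descentPoly]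
    simp only [sum_ribbonStat, ribbon_zero, h2, map_one, one_smul,
      Finset.sum_const, Finset.card_univ, h1, ribbonSum]
  | succ n =>
    rw [ribbonSum, ← sum_composition_succ]
    refine Finset.sum_congr rfl fun I _ => ?_
    rw [sum_ribbonStat, ribbon_eq, Nat.add_sub_cancel, complWord_conjugate]

/-- The solution of the Poincaré equation. -/
noncomputable def poincareSolution (q : K) (n : ℕ) : NCSym K := (qProd q n)⁻¹ • ribbonSum q n

theorem qProd_ne_zero {q : K} (hq : ∀ n : ℕ, 1 ≤ n → q ^ n ≠ 1) (n : ℕ) : qProd q n ≠ 0 :=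
  Finset.prod_ne_zero_iff.mpr fun i _ => sub_ne_zero.mpr (hq (i + 1) (by omega))

theorem isPoincareSolution_poincareSolution {q : K} (hq : ∀ n : ℕ, 1 ≤ n → q ^ n ≠ 1) :
    IsPoincareSolution q (poincareSolution q) where
  homogeneous n := by
    refine Submodule.smul_mem _ _ ?_
    rw [← sum_ribbonStat_smul_ribbon]
    exact Submodule.sum_mem _ fun I _ =>
      Submodule.smul_mem _ _ (ribbon_mem_homogeneousPart K I)
  zero := by simp [poincareSolution, qProd, ribbonSum]
  equation := by
    refine poincare_equation_of_quadratic (fun k y => ?_) fun m => ?_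
    -- In degree 0 the shift does not commute with right multiplication, but there the factor q^0 -
    -- 1 vanishes.
    · cases k with
      | zero => simp
      | succ k =>
        simp only [poincareSolution, ribbonSum, smul_mul_assoc, map_smul, Finset.sum_mul, map_sum,
          firstShift_wordRibbon, firstShift_wordRibbon_mul]
    · have h1 : (q ^ (m + 1) - 1) • poincareSolution q (m + 1) =
          (qProd q m)⁻¹ • ribbonSum q (m + 1) := by
        rw [poincareSolution, qProd_succ, smul_smul]
        congr 1
        have := sub_ne_zero.mpr (hq (m + 1) (by omega))
        field_simp
      rw [h1, ribbonSum_succ, Finset.smul_sum]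
      refine Finset.sum_congr rfl fun p hp => ?_
      obtain rfl := mem_antidiagonal.mp hp
      have h2 := aeval_gaussBinom_mul q (Nat.le_add_right p.1 p.2)
      rw [Nat.add_sub_cancel_left] at h2
      -- The normalization by (q)_n absorbs the Gaussian binomial, turning the weighted recursion
      -- into the plain quadratic one.
      have h3 : (qProd q (p.1 + p.2))⁻¹ * aeval q (gaussBinom (p.1 + p.2) p.1) =
          (qProd q p.1)⁻¹ * (qProd q p.2)⁻¹ := by
        have ha := qProd_ne_zero hq (p.1 + p.2)
        have hb := qProd_ne_zero hq p.1
        have hc := qProd_ne_zero hq p.2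
        field_simp
        linear_combination h2
      rw [smul_smul, h3]
      simp only [poincareSolution, map_smul, mul_smul_comm, smul_mul_assoc, add_mul, smul_add,
        smul_smul]
      congr 2 <;> ring

end

end RibbonPoincare

theorem mainTheorem1 {K : Type*} [Field K] (q : K) (hq : ∀ n : ℕ, 1 ≤ n → q ^ n ≠ 1) :
    -- each sylvester class has exactly one element with the smallest number of inversions
    (∀ (n : ℕ) (σ : Equiv.Perm (Fin n)), ∃! α, RibbonPoincare.IsSylvesterTop α σ) ∧
    -- the Poincaré equation has exactly one solution with constant term `1`
    (∃! g : ℕ → RibbonPoincare.NCSym K, RibbonPoincare.IsPoincareSolution q g) ∧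
    -- the ribbon functions form a basis of each homogeneous component
    (∀ n : ℕ,
      LinearIndependent K (fun I : Composition n => RibbonPoincare.ribbon K I) ∧
      Submodule.span K (Set.range fun I : Composition n => RibbonPoincare.ribbon K I) =
        RibbonPoincare.homogeneousPart K n) ∧
    -- the expansion of `(q)_n g_n` on the ribbon basis
    (∀ g : ℕ → RibbonPoincare.NCSym K, RibbonPoincare.IsPoincareSolution q g → ∀ n : ℕ,
      RibbonPoincare.qProd q n • g n =
        ∑ I : Composition n,
          Polynomial.aeval q
            (∑ σ : Equiv.Perm (Fin n), RibbonPoincare.ribbonStat I σ) •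
              RibbonPoincare.ribbon K I) ∧
    -- the coefficients, which are polynomials in `ℕ[q]`, take the value `n!` at `q = 1`
    (∀ (n : ℕ) (I : Composition n),
      Polynomial.eval 1 (∑ σ : Equiv.Perm (Fin n), RibbonPoincare.ribbonStat I σ) =
        n.factorial) := by
  refine ⟨fun n σ => RibbonPoincare.existsUnique_isSylvesterTop σ,
    ⟨_, RibbonPoincare.isPoincareSolution_poincareSolution hq, fun g hg =>
      hg.unique hq (RibbonPoincare.isPoincareSolution_poincareSolution hq)⟩,
    fun n => ⟨RibbonPoincare.linearIndependent_ribbon K n, RibbonPoincare.span_ribbon K n⟩,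
    fun g hg n => ?_, fun n I => RibbonPoincare.eval_one_sum_ribbonStat I⟩
  rw [hg.unique hq (RibbonPoincare.isPoincareSolution_poincareSolution hq),
    RibbonPoincare.sum_ribbonStat_smul_ribbon, RibbonPoincare.poincareSolution,
    smul_inv_smul₀ (RibbonPoincare.qProd_ne_zero hq n)]
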